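/- **Conventions.** For $m\ge 0$ write $\sigma\in S_m$ as $\sigma=[\sigma(1),\dots,\sigma(m)]$, with products composed as $(\sigma\tau)(i)=\sigma(\tau(i))$, and let $s_i=(i,i+1)$, $1\le i\le m-1$. Every $w\in S_m$ has a unique *canonical presentation* $w=w_1w_2\cdots w_{m-1}$ with $w_j\in R_j=\{1,\ s_j,\ s_js_{j-1},\ \dots,\ s_js_{j-1}\cdots s_1\}$. For an integer $q\ge1$ and $\pi\in S_m$ define - $\ell_q(\pi)$: the number of generators $s_i$ with $i\ge q$ (with multiplicity) in the canonical presentation of $\pi$; - $\mathrm{Del}_q(\pi)=\{\,q<j\le m : \#\{i<j:\pi(i)<\pi(j)\}\le q-1\,\}$; - $\mathrm{Des}_q(\pi)=\{\,q\le i\le m-1 : \pi(i)>\pi(i+1)\text{ or } i+1\in \mathrm{Del}_q(\pi)\,\}$; - $\mathrm{rmaj}_{q,m}(\pi)=\sum_{i\in \mathrm{Des}_q(\pi)}(m-i)$; - $\mathrm{Avoid}_q(m)$: the set of $\sigma\in S_m$ avoiding all $q!$ dashed patterns $(\tau_1-\tau_2-\cdots-\tau_q-(q+2),(q+1))$, $\tau\in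 S_q$; here $\sigma$ contains this pattern if there are positions $p_1<\dots<p_q<k<k+1\le m$ such that $\sigma(p_1),\dots,\sigma(p_q),\sigma(k),\sigma(k+1)$ are in the same relative order as $\tau_1,\dots,\tau_q,q+2,q+1$. **Foata's transformation.** For a nonempty word $r$ and a letter $x$ of a totally ordered alphabet, if the last letter of $r$ is $\le x$ (respectively $>x$), cut $r$ after each letter $\le x$ (respectively $>x$) and move the last letter of each compartment to its beginning; the result is $\gamma_x(r)$. Let $\Phi(x)=x$ for a single letter and $\Phi(rx)=\gamma_x(\Phi(r))\,x$; $\Phi$ acts on $S_n$ via one-line notation. With $\mathrm{rev}[\sigma_1,\dots,\sigma_n]=[\sigma_n,\dots,\sigma_1]$, let $\overleftarrow{\Phi}=\mathrm{rev}\,\Phi\,\mathrm{rev}$. **The map $\Psi_q$.** Let $n,q\ge1$. The map $f_q:S_{n+q-1}\to S_n$ is obtained by replacing, in the canonical presentation of its argument, $s_1,\dots,s_{q-1}$ by $1$ and $s_j$ by $s_{j-q+1}$ for $j\ge q$. For $u\in S_{n+q-1}$ with canonical presentation $u_1\cdots u_{n+q-2}$ and $1\le j\le n-1$ put $g_{q,u}(1)=1$,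 $g_{q,u}(s_j\cdots s_\ell)=s_{j+q-1}\cdots s_{\ell+q-1}$ if $2\le\ell\le j$, and $g_{q,u}(s_j\cdots s_1)=u_{j+q-1}$; for $w\in S_n$ with canonical presentation $w_1\cdots w_{n-1}$ put $g_{q,u}(w)=u_1\cdots u_{q-1}\cdot g_{q,u}(w_1)\cdots g_{q,u}(w_{n-1})\in S_{n+q-1}$. Define $\Psi_q:S_{n+q-1}\to S_{n+q-1}$ by $\Psi_q(v)=g_{q,v}\big(\overleftarrow{\Phi}(f_q(v))\big)$. **Theorem.** Let $n,q\ge 1$ be integers. 1. $\Psi_q$ is a bijection of $S_{n+q-1}$ onto itself. 2. $\mathrm{rmaj}_{q,n+q-1}(v)=\ell_q(\Psi_q(v))$ for every $v\in S_{n+q-1}$. 3. $\mathrm{Del}_q(v^{-1})=\mathrm{Del}_q(\Psi_q(v)^{-1})$ for every $v\in S_{n+q-1}$. 4. $\mathrm{Des}_q(v^{-1})=\mathrm{Des}_q(\Psi_q(v)^{-1})$ for every $v\in S_{n+q-1}$. 5. For all $B_1,B_2\subseteq\{q,\dots,n+q-1\}$, $\Psi_q$ restricts to a bijection of $E=\{\pi\in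 S_{n+q-1}:\mathrm{Des}_q(\pi^{-1})=B_1,\ \mathrm{Del}_q(\pi^{-1})=B_2\}$ onto itself, and $\sum_{\pi\in E}t^{\ell_q(\pi)}=\sum_{\pi\in E}t^{\mathrm{rmaj}_{q,n+q-1}(\pi)}$ as polynomials in $t$. 6. For all $B\subseteq\{q,\dots,n+q-2\}$, $\Psi_q$ restricts to a bijection of $E=\{\pi\in S_{n+q-1}:\pi^{-1}\in\mathrm{Avoid}_q(n+q-1),\ \mathrm{Des}_q(\pi^{-1})=B\}$ onto itself, and $\sum_{\pi\in E}t^{\ell_q(\pi)}=\sum_{\pi\in E}t^{\mathrm{rmaj}_{q,n+q-1}(\pi)}$ as polynomials in $t$. -/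

import Mathlib

/-! Permutation statistics are written with 1-based positions and letters, as in the one-line notation
`σ = [σ(1), …, σ(m)]`.  The group `S_m` is `Equiv.Perm (Fin m)`; the letter `k ∈ {1, …, m}` is the
element of `Fin m` with value `k - 1`.  Products are compositions: `(σ τ)(i) = σ(τ(i))`. -/

namespace FoataQ

open Equiv Finset

/-! ### Foata's second fundamental transformation on words -/

section Words

variable {α : Type*}

/-- Cut a word after every letter satisfying `P`. -/
def cutAfter (P : α → Prop) [DecidablePred P] : List α → List (List α)
  | [] => []
  | y :: ys =>
    if P y then [y] :: cutAfter P ys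
    else match cutAfter P ys with
      | [] => [[y]]
      | b :: bs => (y :: b) :: bs

/-- Move the last letter of a word to its beginning. -/
def moveLastFirst (b : List α) : List α := b.getLast?.toList ++ b.dropLast

/-- The map `γ_x`: if the last letter of `r` is `≤ x` (respectively `> x`), cut `r` after every letter
`≤ x` (respectively `> x`) and move the last letter of each compartment to its beginning. -/
def gammaMap [LinearOrder α] (x : α) (r : List α) : List α :=
  if ∀ z ∈ r.getLast?, z ≤ x then (cutAfter (fun y => y ≤ x) r).flatMap moveLastFirst
  else (cutAfter (fun y => x < y) r).flatMap moveLastFirst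

/-- `Φ` on words: `Φ(x) = x` for a letter `x`, and `Φ(r x) = γ_x(Φ(r)) x`. -/
def foataWord [LinearOrder α] (r : List α) : List α :=
  r.foldl (fun acc x => gammaMap x acc ++ [x]) []

theorem moveLastFirst_perm (b : List α) : (moveLastFirst b).Perm b := by
  rcases List.eq_nil_or_concat b with rfl | ⟨l, x, rfl⟩
  · simp [moveLastFirst]
  · simpa [moveLastFirst] using (List.perm_append_singleton x l).symm

theorem cutAfter_flatten (P : α → Prop) [DecidablePred P] (r : List α) :
    (cutAfter P r).flatten = r := by
  induction r with
  | nil => rfl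
  | cons y ys ih =>
    rw [cutAfter]
    split_ifs with h
    · simp [ih]
    · cases h' : cutAfter P ys with
      | nil => rw [h'] at ih; simp at ih; simp [← ih]
      | cons b bs => rw [h'] at ih; simp at ih; simp [ih]

theorem flatMap_moveLastFirst_perm (L : List (List α)) :
    (L.flatMap moveLastFirst).Perm L.flatten := by
  induction L with
  | nil => simp
  | cons b bs ih =>
    simp only [List.flatMap_cons, List.flatten_cons]
    exact (moveLastFirst_perm b).append ih

theorem gammaMap_perm [LinearOrder α] (x : α) (r : List α) : (gammaMap x r).Perm r := by
  unfold gammaMap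
  split_ifs
  · simpa [cutAfter_flatten] using flatMap_moveLastFirst_perm (cutAfter (fun y => y ≤ x) r)
  · simpa [cutAfter_flatten] using flatMap_moveLastFirst_perm (cutAfter (fun y => x < y) r)

theorem foataWord_concat [LinearOrder α] (r : List α) (x : α) :
    foataWord (r ++ [x]) = gammaMap x (foataWord r) ++ [x] := by
  simp [foataWord]

theorem foataWord_perm [LinearOrder α] (r : List α) : (foataWord r).Perm r := by
  induction r using List.reverseRecOn with
  | nil => simp [foataWord]
  | append_singleton r x ih =>
    rw [foataWord_concat]
    exact ((gammaMap_perm x _).trans ih).append_right [x]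

end Words

/-! ### The transformation on permutations -/

section Permutations

variable {m : ℕ}

/-- The word `σ(1) σ(2) ⋯ σ(m)`. -/
def word (σ : Perm (Fin m)) : List (Fin m) := List.ofFn σ

theorem foataWord_word_length (σ : Perm (Fin m)) : (foataWord (word σ)).length = m := by
  simpa [word] using (foataWord_perm (word σ)).length_eq

theorem foataWord_word_nodup (σ : Perm (Fin m)) : (foataWord (word σ)).Nodup :=
  (foataWord_perm (word σ)).nodup_iff.2 (List.nodup_ofFn.2 σ.injective)

/-- `Φ` on `S_m`: the word of `Φ(σ)` is `Φ` of the word of `σ`. -/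
noncomputable def foata (σ : Perm (Fin m)) : Perm (Fin m) :=
  Equiv.ofBijective
    (fun i => (foataWord (word σ)).get (Fin.cast (foataWord_word_length σ).symm i))
    (Finite.injective_iff_bijective.1 fun i j h => by
      have := (List.nodup_iff_injective_get.1 (foataWord_word_nodup σ)) h
      simpa using this)

theorem word_foata (σ : Perm (Fin m)) : word (foata σ) = foataWord (word σ) := by
  apply List.ext_get
  · rw [foataWord_word_length]; simp [word]
  · intro i h₁ h₂
    simp only [word, foata, List.get_eq_getElem, List.getElem_ofFn]
    rfl

/-- The reverse `[σ(m), …, σ(1)]`. -/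
def rev (σ : Perm (Fin m)) : Perm (Fin m) := σ * Fin.revPerm

/-- The right-to-left Foata transformation `rev Φ rev`. -/
noncomputable def rtlFoata (σ : Perm (Fin m)) : Perm (Fin m) := rev (foata (rev σ))

end Permutations

/-! ### Canonical presentations -/

/-- The Coxeter generator `s_i = (i, i+1)` of `S_m`, `1 ≤ i ≤ m - 1` (and `1` for other `i`). -/
def gen (m i : ℕ) : Perm (Fin m) :=
  if h : 1 ≤ i ∧ i < m then Equiv.swap ⟨i - 1, by omega⟩ ⟨i, h.2⟩ else 1

/-- The product `s_{i₁} s_{i₂} ⋯` in `S_m` for a word `i₁ i₂ ⋯` of indices. -/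
def genProd (m : ℕ) (L : List ℕ) : Perm (Fin m) := (L.map (gen m)).prod

/-- The word of indices `j, j-1, …, l`; it is empty when `l = j + 1`. -/
def run (j l : ℕ) : List ℕ := (List.range' l (j + 1 - l)).reverse

/-- The concatenation of the words `run j (c j)` for `j = 1, …, m - 1`. -/
def presWord (m : ℕ) (c : ℕ → ℕ) : List ℕ :=
  (List.range' 1 (m - 1)).flatMap fun j => run j (c j)

/-- `c` encodes the canonical presentation `w = w_1 ⋯ w_{m-1}` with
`w_j = s_j s_{j-1} ⋯ s_{c j} ∈ {1, s_j, s_j s_{j-1}, …, s_j ⋯ s_1}`; the factor `w_j = 1` is encoded by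
`c j = j + 1`, which is also the value prescribed at the irrelevant indices `j = 0` and `j ≥ m`. -/
def IsCanonical {m : ℕ} (w : Perm (Fin m)) (c : ℕ → ℕ) : Prop :=
  (∀ j, 1 ≤ c j ∧ c j ≤ j + 1) ∧ (∀ j, m ≤ j → c j = j + 1) ∧ w = genProd m (presWord m c)

section Existence

variable {m : ℕ}

theorem apply_inv_self' (w : Perm (Fin m)) (x : Fin m) : w (w⁻¹ x) = x := by
  rw [← Perm.mul_apply, mul_inv_cancel, Perm.one_apply]

theorem genProd_append (L L' : List ℕ) : genProd m (L ++ L') = genProd m L * genProd m L' := by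
  simp [genProd]

theorem gen_fix {i : ℕ} {x : Fin m} (h : i < x.val) : gen m i x = x := by
  unfold gen
  split_ifs with hi
  · apply Equiv.swap_apply_of_ne_of_ne <;> (intro e; rw [e] at h; simp at h; try omega)
  · rfl

theorem genProd_fix {L : List ℕ} {x : Fin m} (h : ∀ i ∈ L, i < x.val) : genProd m L x = x := by
  induction L with
  | nil => simp [genProd]
  | cons i L ih =>
    have := ih fun i hi => h i (List.mem_cons_of_mem _ hi)
    simp only [genProd, List.map_cons, List.prod_cons, Perm.mul_apply] at this ⊢
    rw [this, gen_fix (h i (by simp))]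

theorem genProd_range'_apply (l d : ℕ) (hl : 1 ≤ l) (h : l - 1 + d < m) :
    genProd m (List.range' l d).reverse ⟨l - 1, by omega⟩ = ⟨l - 1 + d, h⟩ := by
  induction d with
  | zero => simp [genProd]
  | succ d ih =>
    have := ih (by omega)
    rw [List.range'_concat, List.reverse_append]
    simp only [genProd, List.map_cons, List.prod_cons, Perm.mul_apply, List.reverse_singleton,
      List.singleton_append] at this ⊢
    rw [this, one_mul, gen, dif_pos ⟨by omega, by omega⟩]
    have e : (⟨l - 1 + d, by omega⟩ : Fin m) = ⟨l + d - 1, by omega⟩ := by ext; simp; omega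
    rw [e, Equiv.swap_apply_left]
    ext; simp; omega

theorem mem_run {j l i : ℕ} (h : i ∈ run j l) : i ≤ j := by
  simp [run, List.mem_range'_1] at h; omega

theorem genProd_run_apply (j l : ℕ) (hl : 1 ≤ l) (hlj : l ≤ j + 1) (hj : j < m) :
    genProd m (run j l) ⟨l - 1, by omega⟩ = ⟨j, hj⟩ := by
  rw [run, genProd_range'_apply l (j + 1 - l) hl (by omega)]
  ext; simp; omega

theorem presWord_succ (k : ℕ) (hk : 1 ≤ k) (c : ℕ → ℕ) :
    presWord (k + 1) c = presWord k c ++ run k (c k) := by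
  obtain ⟨k, rfl⟩ : ∃ k', k = k' + 1 := ⟨k - 1, by omega⟩
  simp only [presWord, Nat.add_sub_cancel, List.range'_concat, List.flatMap_append]
  simp [Nat.add_comm]

theorem mem_presWord {k i : ℕ} {c : ℕ → ℕ} (h : i ∈ presWord k c) : i < k := by
  simp only [presWord, List.mem_flatMap, List.mem_range'_1] at h
  obtain ⟨j, hj, hi⟩ := h
  have := mem_run hi
  omega

theorem presWord_congr {k : ℕ} {c c' : ℕ → ℕ} (h : ∀ j < k, c j = c' j) :
    presWord k c = presWord k c' := by
  unfold presWord
  apply List.flatMap_congr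
  intro j hj
  rw [List.mem_range'_1] at hj
  rw [h j (by omega)]

theorem exists_pres (k : ℕ) (hk : k ≤ m) (w : Perm (Fin m)) (hw : ∀ x : Fin m, k ≤ x.val → w x = x) :
    ∃ c : ℕ → ℕ, (∀ j, 1 ≤ c j ∧ c j ≤ j + 1) ∧ (∀ j, k ≤ j → c j = j + 1) ∧
      w = genProd m (presWord k c) := by
  induction k generalizing w with
  | zero =>
    refine ⟨fun j => j + 1, fun j => ⟨Nat.le_add_left 1 j, le_rfl⟩, fun j _ => rfl, ?_⟩
    ext x
    rw [hw x (Nat.zero_le _)]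
    simp [presWord, genProd]
  | succ k ih =>
    let a : Fin m := ⟨k, by omega⟩
    have hr : (w⁻¹ a).val ≤ k := by
      by_contra hcon
      have h1 := hw (w⁻¹ a) (by omega)
      rw [apply_inv_self'] at h1
      rw [← h1] at hcon
      exact hcon le_rfl
    set l := (w⁻¹ a).val + 1 with hl
    have hR : genProd m (run k l) (w⁻¹ a) = a := by
      have := genProd_run_apply (m := m) k l (by omega) (by omega) (by omega)
      have e : (⟨l - 1, by omega⟩ : Fin m) = w⁻¹ a := by ext; simp [hl]
      rwa [e] at this
    obtain ⟨c, h1, h2, h3⟩ := ih (by omega) (w * (genProd m (run k l))⁻¹) (by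
      intro x hx
      rcases Nat.eq_or_lt_of_le hx with hx | hx
      · have : x = a := by ext; exact hx.symm
        rw [this, Perm.mul_apply, Perm.inv_eq_iff_eq.2 hR.symm, apply_inv_self']
      · have : genProd m (run k l) x = x := genProd_fix fun i hi => by
          have := mem_run hi; omega
        rw [Perm.mul_apply, Perm.inv_eq_iff_eq.2 this.symm, hw x hx])
    refine ⟨Function.update c k l, ?_, ?_, ?_⟩
    · intro j
      by_cases hj : j = k
      · subst hj; simp; omega
      · simpa [hj] using h1 j
    · intro j hj
      rw [Function.update_of_ne (by omega)]
      exact h2 j (by omega)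
    · have hw' : w = genProd m (presWord k c) * genProd m (run k l) := by
        rw [← h3]; simp
      rcases Nat.eq_zero_or_pos k with rfl | hk0
      · have : l = 1 := by omega
        rw [this] at hw'
        rw [hw']
        simp [presWord, run, genProd]
      · rw [presWord_succ k hk0, genProd_append, Function.update_self,
          presWord_congr (c := Function.update c k l) (c' := c)
            (fun j hj => Function.update_of_ne (by omega) _ _)]
        exact hw'

theorem pres_unique (k : ℕ) (hk : k ≤ m) (c c' : ℕ → ℕ) (h : ∀ j, 1 ≤ c j ∧ c j ≤ j + 1)
    (h' : ∀ j, 1 ≤ c' j ∧ c' j ≤ j + 1)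
    (e : genProd m (presWord k c) = genProd m (presWord k c')) : ∀ j < k, c j = c' j := by
  induction k with
  | zero => intro j hj; omega
  | succ k ih =>
    rcases Nat.eq_zero_or_pos k with rfl | hk0
    · intro j hj
      have := h j
      have := h' j
      omega
    · rw [presWord_succ k hk0, presWord_succ k hk0, genProd_append, genProd_append] at e
      have key : ∀ d : ℕ → ℕ, (∀ j, 1 ≤ d j ∧ d j ≤ j + 1) → ∀ hd : d k - 1 < m,
          (genProd m (presWord k d) * genProd m (run k (d k))) ⟨d k - 1, hd⟩ = ⟨k, by omega⟩ := by
        intro d hd hd'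
        rw [Perm.mul_apply, genProd_run_apply k (d k) (hd k).1 (hd k).2 (by omega)]
        exact genProd_fix fun i hi => mem_presWord hi
      have b := h k
      have b' := h' k
      have e1 := key c h (by omega)
      have e2 := key c' h' (by omega)
      rw [e, ← e2] at e1
      have e3 := congrArg Fin.val ((genProd m (presWord k c') * genProd m (run k (c' k))).injective e1)
      simp only at e3
      have e4 : c k = c' k := by omega
      rw [e4] at e
      have e5 := ih (by omega) (mul_right_cancel e)
      intro j hj
      rcases Nat.eq_or_lt_of_le (Nat.lt_succ_iff.1 hj) with rfl | hj
      · exact e4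
      · exact e5 j hj

/-- Every element of `S_m` has exactly one canonical presentation. -/
theorem existsUnique_isCanonical (w : Perm (Fin m)) : ∃! c : ℕ → ℕ, IsCanonical w c := by
  obtain ⟨c, h1, h2, h3⟩ := exists_pres m le_rfl w (fun x hx => absurd x.isLt (by omega))
  refine ⟨c, ⟨h1, h2, h3⟩, ?_⟩
  rintro c' ⟨h1', h2', h3'⟩
  funext j
  rcases Nat.lt_or_ge j m with hj | hj
  · exact pres_unique m le_rfl c' c h1' h1 (h3'.symm.trans h3) j hj
  · rw [h2 j hj, h2' j hj]

end Existence

/-- The canonical presentation of `w ∈ S_m`: its `j`-th factor is `w_j = s_j s_{j-1} ⋯ s_{canon w j}`. -/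
noncomputable def canon {m : ℕ} (w : Perm (Fin m)) : ℕ → ℕ := (existsUnique_isCanonical w).choose

theorem isCanonical_canon {m : ℕ} (w : Perm (Fin m)) : IsCanonical w (canon w) :=
  (existsUnique_isCanonical w).choose_spec.1

/-- The canonical presentation of `w`, as a word in the indices of the Coxeter generators. -/
noncomputable def canonWord {m : ℕ} (w : Perm (Fin m)) : List ℕ := presWord m (canon w)

/-- The `j`-th factor `w_j` of the canonical presentation of `w`. -/
noncomputable def factor {m : ℕ} (w : Perm (Fin m)) (j : ℕ) : Perm (Fin m) :=
  genProd m (run j (canon w j))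

/-! ### The `q`-statistics -/

section Statistics

variable {m : ℕ}

/-- The letter `π(i)` in position `i`, for `1 ≤ i ≤ m` (and `0` for other `i`). -/
def letter (π : Perm (Fin m)) (i : ℕ) : ℕ :=
  if h : 1 ≤ i ∧ i ≤ m then (π ⟨i - 1, by omega⟩).val + 1 else 0

/-- `ℓ_q(π)`: the number of generators in the canonical presentation, not counting `s_1, …, s_{q-1}`. -/
noncomputable def qLength (q : ℕ) (π : Perm (Fin m)) : ℕ :=
  (canonWord π).countP fun i => decide (q ≤ i)

/-- `Des(π)`. -/
def descents (π : Perm (Fin m)) : Finset ℕ :=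
  {i ∈ Finset.Icc 1 (m - 1) | letter π (i + 1) < letter π i}

/-- `Del_q(π)`, for `q ≥ 1`: the `j` with `q < j ≤ m` such that at most `q - 1` indices `i < j` satisfy
`π(i) < π(j)`. -/
def qDel (q : ℕ) (π : Perm (Fin m)) : Finset ℕ :=
  {j ∈ Finset.Icc (q + 1) m | #{i ∈ Finset.Ico 1 j | letter π i < letter π j} < q}

/-- `Des_q(π)`: the `i ≥ q` such that `i ∈ Des(π)` or `i + 1 ∈ Del_q(π)`. -/
def qDes (q : ℕ) (π : Perm (Fin m)) : Finset ℕ :=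
  {i ∈ Finset.Icc q (m - 1) | i ∈ descents π ∨ i + 1 ∈ qDel q π}

/-- `rmaj_{q,m}(π)`, for `π ∈ S_m`. -/
def qRmaj (q : ℕ) (π : Perm (Fin m)) : ℕ := ∑ i ∈ qDes q π, (m - i)

/-- `σ` contains the dashed pattern `(τ_1 - τ_2 - ⋯ - τ_q - (q+2), (q+1))`: there are positions
`p_1 < ⋯ < p_q < k < k + 1` whose letters are in the same relative order as
`τ_1, …, τ_q, q+2, q+1`. -/
def ContainsDashed {q : ℕ} (τ : Perm (Fin q)) (σ : Perm (Fin m)) : Prop :=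
  ∃ (p : Fin q → ℕ) (k : ℕ), StrictMono p ∧ (∀ a, 1 ≤ p a ∧ p a < k) ∧ 1 ≤ k ∧ k + 1 ≤ m ∧
    (∀ a b, letter σ (p a) < letter σ (p b) ↔ τ a < τ b) ∧
    (∀ a, letter σ (p a) < letter σ (k + 1)) ∧ letter σ (k + 1) < letter σ k

/-- `Avoid_q(m)`: the permutations in `S_m` that avoid all `q!` dashed patterns in `Pat(q)`. -/
def qAvoid (q m : ℕ) : Set (Perm (Fin m)) := {σ | ∀ τ : Perm (Fin q), ¬ ContainsDashed τ σ}

open Classical in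
/-- The generating polynomial `∑_{π ∈ A} t^{stat(π)}`. -/
noncomputable def genPoly (A : Set (Perm (Fin m))) (stat : Perm (Fin m) → ℕ) : Polynomial ℤ :=
  ∑ π : Perm (Fin m) with π ∈ A, (Polynomial.X : Polynomial ℤ) ^ stat π

end Statistics

/-! ### The covering map, its local inverses, and `Ψ_q` -/

/-- `f_q : S_{n+q-1} → S_n`: in the canonical presentation, replace `s_1, …, s_{q-1}` by `1` and `s_j` by
`s_{j-q+1}` for `j ≥ q`. -/
noncomputable def fMap (n q : ℕ) (w : Perm (Fin (n + q - 1))) : Perm (Fin n) :=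
  ((canonWord w).map fun j => if j < q then 1 else gen n (j - q + 1)).prod

/-- `g_{q,u}` on the factor `w_j = s_j s_{j-1} ⋯ s_l` (with `l = j + 1` for `w_j = 1`). -/
noncomputable def gFactor (n q : ℕ) (u : Perm (Fin (n + q - 1))) (j l : ℕ) :
    Perm (Fin (n + q - 1)) :=
  if l = 1 then factor u (j + q - 1) else genProd (n + q - 1) (run (j + q - 1) (l + q - 1))

/-- `g_{q,u} : S_n → S_{n+q-1}`, `g_{q,u}(w) = u_1 ⋯ u_{q-1} g_{q,u}(w_1) ⋯ g_{q,u}(w_{n-1})`. -/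
noncomputable def gMap (n q : ℕ) (u : Perm (Fin (n + q - 1))) (w : Perm (Fin n)) :
    Perm (Fin (n + q - 1)) :=
  ((List.range' 1 (q - 1)).map (factor u)).prod *
    ((List.range' 1 (n - 1)).map fun j => gFactor n q u j (canon w j)).prod

/-- `Ψ_q(v) = g_{q,v}((rev Φ rev)(f_q(v)))`. -/
noncomputable def Psi (n q : ℕ) (v : Perm (Fin (n + q - 1))) : Perm (Fin (n + q - 1)) :=
  gMap n q v (rtlFoata (fMap n q v))

end FoataQ

open FoataQ

/-! Everything is read off the code `c = canon v`. Right multiplication by `s_j ⋯ s_{c j}` inserts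
the letter `j` (letters counted from 0) at place `c j` of the one-line word, so that word is
`insWord c m` (`word_map_val`) and `c j - 1` counts the smaller letters to the left of `j`. Hence `c
i ≤ c (i - 1)` says that `i` is a descent of `v⁻¹`, and for `j > q` the condition `j ∈ Del_q(v⁻¹)`
says `c (j - 1) ≤ q` (`mem_qDel_inv`).

The map `f_q` shifts the indices and truncates the code to `max (c - (q - 1)) 1` (`canon_fMap`). It
turns the `q`-statistics of `v` into classical ones of `f_q(v)`: `ℓ_q(v)` is its inversion number
(`qLength_eq_sum`), `Des_q(v⁻¹)` is the shifted descent set of its inverse (`mem_qDes_inv`), and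
`Des_q(v)` is its own shifted descent set (`mem_qDes`, which rests on `qDescent_insWord`).

On `S_n`, Foata's argument shows that `rev Φ rev` carries the reverse major index to the inversion
number (`sum_code_rtlFoata`), keeps the descents of the inverse (`canon_rtlFoata_le`) and keeps the
left-to-right minima, which are the letters with code 1 (`canon_rtlFoata_eq_one`). This last
invariance makes the lift consistent. For `j ≥ q`, `g_{q,v}` copies `c j` from `v` exactly where the
new code is 1, and these are the places with `c j ≤ q`, where truncation had forgotten `c j`.
Therefore `f_q ∘ Ψ_q = (rev Φ rev) ∘ f_q` (`fMap_Psi`), nothing is lost, and all the claims follow.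
Avoidance enters because `Des_q` and `Del_q` determine it (`mem_qAvoid_iff`). -/

namespace FoataQ

open Equiv Finset

/-! ### Foata's transformation on words -/

section Words

variable {α : Type*}

/-- Words that are concatenations of compartments, each having its last letter as its only letter
in `P`. -/
inductive Compartments (P : α → Prop) : List α → Prop
  | nil : Compartments P []
  | append (B : List α) (s : α) (r : List α) (hB : ∀ b ∈ B, ¬ P b) (hs : P s)
      (hr : Compartments P r) : Compartments P (B ++ s :: r)

theorem compartments_of_getLast (P : α → Prop) (r : List α) (h : ∀ z ∈ r.getLast?, P z) :
    Compartments P r := by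
  induction r with
  | nil => exact .nil
  | cons y ys ih =>
    have h' : ∀ z ∈ ys.getLast?, P z := fun z hz => h z (by
      cases ys with
      | nil => simp at hz
      | cons a l => simpa using hz)
    by_cases hy : P y
    · exact Compartments.append [] y ys (by simp) hy (ih h')
    · cases ih h' with
      | nil => exact absurd (h y (by simp)) hy
      | append B s r hB hs hr =>
        refine Compartments.append (y :: B) s r ?_ hs hr
        simpa [hy] using hB

/-- Cut a word after every letter in `P` and move the last letter of each compartment to its
beginning. -/
def rotate (P : α → Prop) [DecidablePred P] (r : List α) : List α :=
  (cutAfter P r).flatMap moveLastFirst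

theorem cutAfter_append (P : α → Prop) [DecidablePred P] (B : List α) (s : α) (r : List α)
    (hB : ∀ b ∈ B, ¬ P b) (hs : P s) :
    cutAfter P (B ++ s :: r) = (B ++ [s]) :: cutAfter P r := by
  induction B with
  | nil => simp [cutAfter, hs]
  | cons b B ih =>
    have := ih fun x hx => hB x (List.mem_cons_of_mem _ hx)
    simp [cutAfter, hB b (by simp), this]

theorem rotate_nil (P : α → Prop) [DecidablePred P] : rotate P [] = [] := rfl

theorem rotate_append (P : α → Prop) [DecidablePred P] (B : List α) (s : α) (r : List α)
    (hB : ∀ b ∈ B, ¬ P b) (hs : P s) : rotate P (B ++ s :: r) = s :: (B ++ rotate P r) := by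
  simp [rotate, cutAfter_append P B s r hB hs, moveLastFirst]

/-- A compartment has a single letter in `P`, so the rotation moves it only past letters outside
`P`; the order within each of the two classes is untouched. -/
theorem filter_rotate (P Q : α → Prop) [DecidablePred P] [DecidablePred Q] (r : List α)
    (hr : Compartments P r) (hQ : (∀ x, P x ↔ Q x) ∨ ∀ x, ¬ P x ↔ Q x) :
    (rotate P r).filter (fun x => decide (Q x)) = r.filter (fun x => decide (Q x)) := by
  induction hr with
  | nil => rfl
  | append B s r hB hs _ ih =>
    rw [rotate_append P B s r hB hs]
    rcases hQ with hQ | hQ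
    · have : B.filter (fun x => decide (Q x)) = [] := by
        simpa [← hQ] using hB
      simp [ih, this, (hQ s).1 hs]
    · have : ¬ Q s := fun h => (hQ s).2 h hs
      simp [ih, this]

theorem head_rotate (P : α → Prop) [DecidablePred P] (r : List α) (hr : Compartments P r) :
    ∀ z ∈ (rotate P r).head?, P z := by
  cases hr with
  | nil => simp [rotate_nil]
  | append B s r hB hs _ => simpa [rotate_append P B s r hB hs] using hs

theorem append_inj_of_head (P : α → Prop) (B B' R R' : List α) (hB : ∀ b ∈ B, ¬ P b)
    (hB' : ∀ b ∈ B', ¬ P b) (hR : ∀ z ∈ R.head?, P z) (hR' : ∀ z ∈ R'.head?, P z)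
    (h : B ++ R = B' ++ R') : B = B' ∧ R = R' := by
  induction B generalizing B' with
  | nil =>
    cases B' with
    | nil => exact ⟨rfl, h⟩
    | cons b B' =>
      simp only [List.nil_append] at h
      subst h
      exact absurd (hR b (by simp)) (hB' b (by simp))
  | cons a B ih =>
    cases B' with
    | nil =>
      simp only [List.nil_append] at h
      subst h
      exact absurd (hR' a (by simp)) (hB a (by simp))
    | cons b B' =>
      simp only [List.cons_append, List.cons.injEq] at h
      obtain ⟨h1, h2⟩ := ih B' (fun x hx => hB x (by simp [hx])) (fun x hx => hB' x (by simp [hx])) h.2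
      exact ⟨by rw [h.1, h1], h2⟩

/-- After the rotation each compartment begins with its only letter in `P`, so cutting before those
letters recovers the compartments. -/
theorem rotate_injOn (P : α → Prop) [DecidablePred P] (r r' : List α) (hr : Compartments P r)
    (hr' : Compartments P r') (h : rotate P r = rotate P r') : r = r' := by
  induction hr generalizing r' with
  | nil =>
    cases hr' with
    | nil => rfl
    | append B s r hB hs _ => simp [rotate_nil, rotate_append P B s r hB hs] at h
  | append B s r hB hs hr ih =>
    cases hr' with
    | nil => simp [rotate_nil, rotate_append P B s r hB hs] at h
    | append B' s' r' hB' hs' hr' =>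
      rw [rotate_append P B s r hB hs, rotate_append P B' s' r' hB' hs', List.cons.injEq] at h
      obtain ⟨h1, h2⟩ := append_inj_of_head P B B' _ _ hB hB' (head_rotate P r hr)
        (head_rotate P r' hr') h.2
      rw [h.1, h1, ih r' hr' h2]

theorem rotate_perm (P : α → Prop) [DecidablePred P] (r : List α) : (rotate P r).Perm r := by
  simpa [rotate, cutAfter_flatten] using flatMap_moveLastFirst_perm (cutAfter P r)

/-- In a word without repetitions, `[a, b].Sublist l` expresses that `a` stands before `b`. In this
form relative order passes through filters and through the insertion of other letters. -/
theorem pair_sublist_filter (p : α → Bool) (a b : α) (ha : p a = true) (hb : p b = true)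
    (l : List α) : [a, b].Sublist (l.filter p) ↔ [a, b].Sublist l := by
  refine ⟨fun h => h.trans List.filter_sublist, fun h => ?_⟩
  simpa [ha, hb] using h.filter p

theorem pair_sublist_append_singleton (a b x : α) (l : List α) :
    [a, b].Sublist (l ++ [x]) ↔ [a, b].Sublist l ∨ a ∈ l ∧ b = x := by
  rw [← List.reverse_sublist]
  simp only [List.reverse_append, List.reverse_cons, List.reverse_nil, List.nil_append,
    List.cons_append, List.sublist_cons_iff, List.cons.injEq]
  rw [show [b, a] = [a, b].reverse from rfl, List.reverse_sublist]
  constructor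
  · rintro (h | ⟨t, ⟨rfl, rfl⟩, h⟩)
    · exact Or.inl h
    · exact Or.inr ⟨by simpa using h, rfl⟩
  · rintro (h | ⟨h, rfl⟩)
    · exact Or.inl h
    · exact Or.inr ⟨[a], ⟨rfl, rfl⟩, by simpa using h⟩

variable [LinearOrder α]

theorem gammaMap_cases (x : α) (r : List α) :
    ((∀ z ∈ r.getLast?, z ≤ x) ∧ Compartments (fun y => y ≤ x) r ∧
      gammaMap x r = rotate (fun y => y ≤ x) r) ∨
    (¬ (∀ z ∈ r.getLast?, z ≤ x) ∧ Compartments (fun y => x < y) r ∧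
      gammaMap x r = rotate (fun y => x < y) r) := by
  by_cases h : ∀ z ∈ r.getLast?, z ≤ x
  · exact Or.inl ⟨h, compartments_of_getLast _ _ h, by rw [gammaMap, if_pos h, rotate]⟩
  · refine Or.inr ⟨h, compartments_of_getLast _ _ ?_, by rw [gammaMap, if_neg h, rotate]⟩
    push Not at h
    obtain ⟨z, hz, hz'⟩ := h
    intro y hy
    rw [Option.mem_def] at hz hy
    rw [hz] at hy
    cases hy
    exact hz'

theorem filter_le_gammaMap (x : α) (r : List α) :
    (gammaMap x r).filter (fun y => decide (y ≤ x)) = r.filter (fun y => decide (y ≤ x)) := by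
  rcases gammaMap_cases x r with ⟨_, hc, h⟩ | ⟨_, hc, h⟩ <;> rw [h] <;>
    exact filter_rotate _ _ r hc (by simp)

theorem filter_lt_gammaMap (x : α) (r : List α) :
    (gammaMap x r).filter (fun y => decide (x < y)) = r.filter (fun y => decide (x < y)) := by
  rcases gammaMap_cases x r with ⟨_, hc, h⟩ | ⟨_, hc, h⟩ <;> rw [h] <;>
    exact filter_rotate _ _ r hc (by simp)

/-- The first letter of the image is `≤ x` or `> x` according to the case that was applied, so the
two cases have no common nonempty value. -/
theorem gammaMap_injective (x : α) : Function.Injective (gammaMap x) := by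
  have key : ∀ r r' : List α, Compartments (fun y => y ≤ x) r → Compartments (fun y => x < y) r' →
      rotate (fun y => y ≤ x) r = rotate (fun y => x < y) r' → r = r' := by
    intro r r' hr hr' h
    have h1 := head_rotate _ r hr
    have h2 := head_rotate _ r' hr'
    rw [← h] at h2
    cases hr with
    | nil =>
      cases hr' with
      | nil => rfl
      | append B s r hB hs _ => simp [rotate_nil, rotate_append _ B s r hB hs] at h
    | append B s r hB hs _ =>
      rw [rotate_append _ B s r hB hs] at h1 h2
      exact absurd (h1 s (by simp)) (not_le.2 (h2 s (by simp)))
  intro r r' h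
  rcases gammaMap_cases x r with ⟨_, hc, e⟩ | ⟨_, hc, e⟩ <;>
    rcases gammaMap_cases x r' with ⟨_, hc', e'⟩ | ⟨_, hc', e'⟩ <;> rw [e, e'] at h
  · exact rotate_injOn _ _ _ hc hc' h
  · exact key _ _ hc hc' h
  · exact (key _ _ hc' hc h.symm).symm
  · exact rotate_injOn _ _ _ hc hc' h

theorem foataWord_injective : Function.Injective (foataWord : List α → List α) := by
  intro r
  induction r using List.reverseRecOn with
  | nil =>
    intro r' h
    have := (foataWord_perm r').length_eq
    rw [← h] at this
    exact (List.length_eq_zero_iff.1 (by simpa [foataWord] using this.symm)).symm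
  | append_singleton r x ih =>
    intro r' h
    rcases List.eq_nil_or_concat r' with rfl | ⟨r', y, rfl⟩
    · rw [foataWord_concat] at h
      simp [foataWord] at h
    · rw [foataWord_concat, List.concat_eq_append, foataWord_concat] at h
      obtain ⟨h1, h2⟩ := List.append_inj' h rfl
      simp only [List.cons.injEq, and_true] at h2
      subst h2
      rw [ih (gammaMap_injective x h1), List.concat_eq_append]

theorem getLast?_foataWord (r : List α) : (foataWord r).getLast? = r.getLast? := by
  rcases List.eq_nil_or_concat r with rfl | ⟨r, x, rfl⟩
  · rfl
  · simp [foataWord_concat]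

/-! ### Relative order of two letters -/

theorem pair_sublist_gammaMap (x a b : α) (r : List α) (h : a ≤ x ∧ b ≤ x ∨ x < a ∧ x < b) :
    [a, b].Sublist (gammaMap x r) ↔ [a, b].Sublist r := by
  rcases h with ⟨ha, hb⟩ | ⟨ha, hb⟩
  · rw [← pair_sublist_filter (fun y => decide (y ≤ x)) a b (by simpa) (by simpa),
      filter_le_gammaMap, pair_sublist_filter _ a b (by simpa) (by simpa)]
  · rw [← pair_sublist_filter (fun y => decide (x < y)) a b (by simpa) (by simpa),
      filter_lt_gammaMap, pair_sublist_filter _ a b (by simpa) (by simpa)]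

/-- Foata's transformation preserves the relative order of consecutive letters. -/
theorem pair_sublist_foataWord (a b : α) (hab : a < b) (hcov : ∀ z, z ≤ a ∨ b ≤ z) (r : List α)
    (hr : r.Nodup) : [a, b].Sublist (foataWord r) ↔ [a, b].Sublist r := by
  induction r using List.reverseRecOn with
  | nil => rfl
  | append_singleton r x ih =>
    rw [List.nodup_append] at hr
    have hx : x ∉ r := fun h => hr.2.2 x h x (by simp) rfl
    have hx' : x ∉ foataWord r := fun h => hx ((foataWord_perm r).mem_iff.1 h)
    rw [foataWord_concat, pair_sublist_append_singleton, pair_sublist_append_singleton,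
      ← ih hr.1, (gammaMap_perm x _).mem_iff, (foataWord_perm r).mem_iff]
    refine or_congr ?_ Iff.rfl
    rcases le_or_gt b x with h | h
    · exact pair_sublist_gammaMap x a b _ (Or.inl ⟨hab.le.trans h, h⟩)
    · rcases lt_or_ge x a with h' | h'
      · exact pair_sublist_gammaMap x a b _ (Or.inr ⟨h', h⟩)
      -- No letter lies strictly between `a` and `b`, so the only remaining value is `x = a`. Then
      -- `a` does not occur in `r`, and both sides are false.
      · have e : x = a := ((hcov x).resolve_right (not_le.2 h)).antisymm h'
        subst e
        refine ⟨fun h => absurd ?_ hx', fun h => absurd (h.subset (by simp)) hx'⟩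
        exact (gammaMap_perm x _).mem_iff.1 (h.subset (by simp))

/-- Foata's transformation preserves the right-to-left minima. -/
theorem rtlMin_foataWord (b : α) (r : List α) (hr : r.Nodup) :
    (∀ a ∈ r, a < b → [a, b].Sublist (foataWord r)) ↔ ∀ a ∈ r, a < b → [a, b].Sublist r := by
  induction r using List.reverseRecOn with
  | nil => simp
  | append_singleton r x ih =>
    rw [List.nodup_append] at hr
    have hx : x ∉ r := fun h => hr.2.2 x h x (by simp) rfl
    have hx' : x ∉ gammaMap x (foataWord r) := fun h =>
      hx ((foataWord_perm r).mem_iff.1 ((gammaMap_perm x _).mem_iff.1 h))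
    have hmem : ∀ a, a ∈ gammaMap x (foataWord r) ↔ a ∈ r := fun a =>
      (gammaMap_perm x _).mem_iff.trans (foataWord_perm r).mem_iff
    simp only [foataWord_concat, pair_sublist_append_singleton, hmem]
    -- For `b < x` all letters involved are `≤ x` and keep their order; for `b = x` the letter is
    -- last, hence a minimum; for `x < b` the final `x` prevents `b` from being one, on both sides.
    rcases lt_trichotomy b x with h | rfl | h
    · have e : ∀ a, a < b → ([a, b].Sublist (gammaMap x (foataWord r)) ↔
          [a, b].Sublist (foataWord r)) := fun a ha =>
        pair_sublist_gammaMap x a b _ (Or.inl ⟨(ha.trans h).le, h.le⟩)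
      constructor
      · intro H a ha hab
        rcases List.mem_append.1 ha with ha' | ha'
        · refine Or.inl ((ih hr.1).1 (fun a' ha1 ha2 => ?_) a ha' hab)
          exact (e a' ha2).1 ((H a' (by simp [ha1]) ha2).resolve_right fun h' => h.ne h'.2)
        · rw [List.mem_singleton] at ha'
          exact absurd (ha' ▸ hab) h.not_gt
      · intro H a ha hab
        rcases List.mem_append.1 ha with ha' | ha'
        · refine Or.inl ((e a hab).2 ((ih hr.1).2 (fun a' ha1 ha2 => ?_) a ha' hab))
          exact (H a' (by simp [ha1]) ha2).resolve_right fun h' => h.ne h'.2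
        · rw [List.mem_singleton] at ha'
          exact absurd (ha' ▸ hab) h.not_gt
    · refine ⟨fun _ a ha hab => ?_, fun _ a ha hab => ?_⟩ <;>
      · rcases List.mem_append.1 ha with ha | ha
        · exact Or.inr ⟨ha, rfl⟩
        · rw [List.mem_singleton] at ha
          exact absurd hab (ha ▸ lt_irrefl _)
    · refine ⟨fun H => ?_, fun H => ?_⟩
      · rcases H x (by simp) h with h1 | h1
        · exact absurd (h1.subset (by simp)) hx'
        · exact absurd h1.1 hx
      · rcases H x (by simp) h with h1 | h1
        · exact absurd (h1.subset (by simp)) hx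
        · exact absurd h1.1 hx

/-! ### Weak coinversions and the major index -/

/-- The number of pairs `(x, y)` with `x ∈ a`, `y ∈ b` and `x ≤ y`. -/
def crossLe (a b : List α) : ℕ := (a.map fun x => b.countP fun y => decide (x ≤ y)).sum

/-- The number of pairs of positions `i < j` with `r_i ≤ r_j`. -/
def coinv : List α → ℕ
  | [] => 0
  | x :: l => l.countP (fun y => decide (x ≤ y)) + coinv l

theorem coinv_append (a b : List α) : coinv (a ++ b) = coinv a + coinv b + crossLe a b := by
  induction a with
  | nil => simp [coinv, crossLe]
  | cons x a ih =>
    simp only [List.cons_append, coinv, ih, crossLe, List.countP_append, List.map_cons,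
      List.sum_cons]
    ring

theorem crossLe_perm {a a' b b' : List α} (ha : a.Perm a') (hb : b.Perm b') :
    crossLe a b = crossLe a' b' := by
  unfold crossLe
  rw [(ha.map _).sum_eq]
  congr 1
  exact List.map_congr_left fun x _ => hb.countP_eq _

theorem crossLe_singleton (a : List α) (x : α) :
    crossLe a [x] = a.countP fun y => decide (y ≤ x) := by
  induction a with
  | nil => rfl
  | cons y a ih =>
    simp only [crossLe, List.map_cons, List.sum_cons] at ih ⊢
    rw [ih, List.countP_cons, List.countP_cons, List.countP_nil, add_comm, zero_add]

theorem coinv_concat (r : List α) (x : α) :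
    coinv (r ++ [x]) = coinv r + r.countP fun y => decide (y ≤ x) := by
  rw [coinv_append, crossLe_singleton]
  simp [coinv]

/-- In a compartment `B s` one has `s ≤ x < b` for all `b ∈ B`; moving `s` to the front gains `|B|`
pairs. The letters of the blocks `B` are exactly the letters `> x`. -/
theorem coinv_rotate_le (x : α) (r : List α) (hr : Compartments (fun y => y ≤ x) r) :
    coinv (rotate (fun y => y ≤ x) r) = coinv r + r.countP fun y => decide (x < y) := by
  induction hr with
  | nil => rfl
  | append B s r hB hs _ ih =>
    rw [rotate_append _ B s r hB hs, List.append_cons, ← List.cons_append, coinv_append, ih,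
      coinv_append (B ++ [s]), crossLe_perm (List.perm_append_singleton s B).symm (rotate_perm _ r),
      coinv_concat]
    have h1 : (B.countP fun y => decide (s ≤ y)) = B.length :=
      List.countP_eq_length.2 fun b hb => by
        simpa using hs.trans (not_le.1 (hB b hb)).le
    have h2 : (B.countP fun y => decide (y ≤ s)) = 0 :=
      List.countP_eq_zero.2 fun b hb => by
        simpa using hs.trans_lt (not_le.1 (hB b hb))
    have h3 : (B.countP fun y => decide (x < y)) = B.length :=
      List.countP_eq_length.2 fun b hb => by simpa using hB b hb
    have h4 : ([s].countP fun y => decide (x < y)) = 0 := by simpa using hs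
    simp only [coinv, h1, h2, List.countP_append, h3, h4]
    ring

/-- Now `b ≤ x < s`, so each compartment loses `|B|` pairs; the total loss is the number of letters
`≤ x`. -/
theorem coinv_rotate_lt (x : α) (r : List α) (hr : Compartments (fun y => x < y) r) :
    coinv (rotate (fun y => x < y) r) + r.countP (fun y => decide (y ≤ x)) = coinv r := by
  induction hr with
  | nil => rfl
  | append B s r hB hs _ ih =>
    rw [rotate_append _ B s r hB hs, List.append_cons, ← List.cons_append, coinv_append,
      coinv_append (B ++ [s]), crossLe_perm (List.perm_append_singleton s B).symm (rotate_perm _ r),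
      coinv_concat, ← ih]
    have h1 : (B.countP fun y => decide (s ≤ y)) = 0 :=
      List.countP_eq_zero.2 fun b hb => by
        simpa using (not_lt.1 (hB b hb)).trans_lt hs
    have h2 : (B.countP fun y => decide (y ≤ s)) = B.length :=
      List.countP_eq_length.2 fun b hb => by
        simpa using (not_lt.1 (hB b hb)).trans hs.le
    have h3 : (B.countP fun y => decide (y ≤ x)) = B.length :=
      List.countP_eq_length.2 fun b hb => by simpa using hB b hb
    have h4 : ([s].countP fun y => decide (y ≤ x)) = 0 := by simpa using hs
    simp only [coinv, h1, h2, List.countP_append, h3, h4]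
    ring

/-- Appending `x` adds one pair for each letter `≤ x`. This completes the gain of the first case to
the full length and cancels the loss of the second. -/
theorem coinv_gammaMap_concat (x : α) (r : List α) :
    coinv (gammaMap x r ++ [x]) =
      coinv r + if ∀ z ∈ r.getLast?, z ≤ x then r.length else 0 := by
  rw [coinv_concat, (gammaMap_perm x r).countP_eq]
  rcases gammaMap_cases x r with ⟨h, hc, e⟩ | ⟨h, hc, e⟩
  · rw [if_pos h, e, coinv_rotate_le x r hc, add_assoc]
    congr 1
    rw [List.length_eq_countP_add_countP (fun y => decide (x < y))]
    congr 1
    exact List.countP_congr fun y _ => by simp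
  · rw [if_neg h, e, coinv_rotate_lt x r hc, add_zero]

/-- The sum over the weak descents of a word of the lengths of the suffixes that follow them. -/
def rmajWord : List α → ℕ
  | [] => 0
  | x :: l => rmajWord l + if ∀ z ∈ l.head?, z ≤ x then l.length else 0

theorem coinv_foataWord_reverse (l : List α) : coinv (foataWord l.reverse) = rmajWord l := by
  induction l with
  | nil => rfl
  | cons x l ih =>
    rw [List.reverse_cons, foataWord_concat, coinv_gammaMap_concat, ih, getLast?_foataWord,
      List.getLast?_reverse, (foataWord_perm _).length_eq, List.length_reverse, rmajWord]

end Words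

/-! ### Words built by insertion -/

/-- The word on the letters `0, …, k - 1` obtained by inserting each letter `j` in turn, at the (1-based)
position `c j`. -/
def insWord (c : ℕ → ℕ) : ℕ → List ℕ
  | 0 => []
  | k + 1 => (insWord c k).take (c k - 1) ++ k :: (insWord c k).drop (c k - 1)

/-- The sequences that encode canonical presentations: `1 ≤ c j ≤ j + 1`. -/
def IsCode (c : ℕ → ℕ) : Prop := ∀ j, 1 ≤ c j ∧ c j ≤ j + 1

section Insertion

variable {c : ℕ → ℕ}

theorem insWord_succ (c : ℕ → ℕ) (k : ℕ) : insWord c (k + 1) =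
    (insWord c k).take (c k - 1) ++ k :: (insWord c k).drop (c k - 1) := rfl

theorem insWord_succ_perm (c : ℕ → ℕ) (k : ℕ) : (insWord c (k + 1)).Perm (k :: insWord c k) := by
  rw [insWord_succ]
  refine List.perm_middle.trans ?_
  rw [List.take_append_drop]

@[simp]
theorem length_insWord (c : ℕ → ℕ) (k : ℕ) : (insWord c k).length = k := by
  induction k with
  | zero => rfl
  | succ k ih => rw [(insWord_succ_perm c k).length_eq, List.length_cons, ih]

theorem mem_insWord (c : ℕ → ℕ) (k a : ℕ) : a ∈ insWord c k ↔ a < k := by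
  induction k with
  | zero => simp [insWord]
  | succ k ih => rw [(insWord_succ_perm c k).mem_iff, List.mem_cons, ih]; omega

theorem nodup_insWord (c : ℕ → ℕ) (k : ℕ) : (insWord c k).Nodup := by
  induction k with
  | zero => simp [insWord]
  | succ k ih =>
    rw [(insWord_succ_perm c k).nodup_iff, List.nodup_cons]
    exact ⟨by simp [mem_insWord], ih⟩

theorem getD_insWord_of_ge {k x d : ℕ} (h : k ≤ x) : (insWord c k).getD x d = d := by
  simp [List.getD_eq_getElem?_getD, List.getElem?_eq_none (l := insWord c k) (i := x) (by simpa)]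

theorem getD_insWord_lt {k x : ℕ} (d : ℕ) (h : x < k) :
    (insWord c k).getD x d < k := by
  rw [← mem_insWord c, List.getD_eq_getElem _ _ (by simpa)]
  exact List.getElem_mem _

theorem getD_insWord_of_lt (hc : IsCode c) {k x : ℕ} (d e : ℕ) (h : x < c k - 1) :
    (insWord c (k + 1)).getD x d = (insWord c k).getD x e := by
  have := hc k
  rw [insWord_succ, List.getD_append _ _ _ _ (by simp; omega),
    List.getD_eq_getElem _ _ (by simp; omega), List.getD_eq_getElem _ _ (by simp; omega),
    List.getElem_take]

theorem getD_insWord_self (hc : IsCode c) {k x : ℕ} (d : ℕ) (h : x = c k - 1) :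
    (insWord c (k + 1)).getD x d = k := by
  have := hc k
  rw [insWord_succ, List.getD_append_right _ _ _ _ (by simp; omega)]
  have : x - (List.take (c k - 1) (insWord c k)).length = 0 := by simp; omega
  rw [this]
  rfl

theorem getD_insWord_of_gt (hc : IsCode c) {k x : ℕ} (d e : ℕ) (h : c k - 1 < x) (h' : x ≤ k) :
    (insWord c (k + 1)).getD x d = (insWord c k).getD (x - 1) e := by
  have := hc k
  rw [insWord_succ, List.getD_append_right _ _ _ _ (by simp; omega)]
  have : x - (List.take (c k - 1) (insWord c k)).length = (x - c k) + 1 := by simp; omega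
  rw [this, List.getD_cons_succ, List.getD_eq_getElem _ _ (by simp; omega),
    List.getD_eq_getElem _ _ (by simp; omega), List.getElem_drop]
  congr 1
  omega

/-! ### The word of a canonical presentation -/

variable {m : ℕ}

theorem gen_val {i : ℕ} (h1 : 1 ≤ i) (h2 : i < m) (x : Fin m) : (gen m i x).val =
    if x.val = i - 1 then i else if x.val = i then i - 1 else x.val := by
  rw [gen, dif_pos ⟨h1, h2⟩, Equiv.swap_apply_def]
  simp only [Fin.ext_iff]
  split_ifs <;> rfl

theorem genProd_range'_val (l d : ℕ) (hl : 1 ≤ l) (h : l - 1 + d < m) (x : Fin m) :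
    (genProd m (List.range' l d).reverse x).val =
      if x.val = l - 1 then l - 1 + d
      else if l - 1 < x.val ∧ x.val ≤ l - 1 + d then x.val - 1 else x.val := by
  induction d with
  | zero =>
    simp [genProd]
    split_ifs <;> omega
  | succ d ih =>
    have := ih (by omega)
    rw [List.range'_concat, List.reverse_append, List.reverse_singleton, List.singleton_append]
    simp only [genProd, List.map_cons, List.prod_cons, Perm.mul_apply] at this ⊢
    rw [gen_val (by omega) (by omega), this]
    split_ifs <;> omega

theorem genProd_run_val (j l : ℕ) (hl : 1 ≤ l) (hlj : l ≤ j + 1) (hj : j < m) (x : Fin m) :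
    (genProd m (run j l) x).val =
      if x.val = l - 1 then j
      else if l - 1 < x.val ∧ x.val ≤ j then x.val - 1 else x.val := by
  rw [run, genProd_range'_val l _ hl (by omega)]
  split_ifs <;> omega

/-- The factor `run k (c k)` acts on positions as a cycle sending `c k - 1` to `k` and lowering the
positions after it up to `k`; composing with it inserts `k` into the word. The default value `x.val`
records that positions beyond the word are fixed. -/
theorem genProd_presWord_val (hc : IsCode c) (k : ℕ) (hk : k ≤ m) (x : Fin m) :
    (genProd m (presWord k c) x).val = (insWord c k).getD x.val x.val := by
  induction k generalizing x with
  | zero => simp [presWord, genProd, insWord]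
  | succ k ih =>
    have h1 := hc k
    have e : genProd m (presWord (k + 1) c) =
        genProd m (presWord k c) * genProd m (run k (c k)) := by
      rcases Nat.eq_zero_or_pos k with rfl | hk0
      · have : c 0 = 1 := by omega
        simp [presWord, run, genProd, this]
      · rw [presWord_succ k hk0, genProd_append]
    rw [e, Perm.mul_apply, ih (by omega)]
    have hr := genProd_run_val (m := m) k (c k) h1.1 h1.2 (by omega) x
    rw [hr]
    split_ifs with h2 h3
    · rw [getD_insWord_of_ge le_rfl, getD_insWord_self hc _ h2]
    · rw [getD_insWord_of_gt hc _ _ h3.1 h3.2]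
    · rcases lt_or_ge x.val (c k - 1) with h4 | h4
      · rw [getD_insWord_of_lt hc _ _ h4]
      · rw [getD_insWord_of_ge (by omega), getD_insWord_of_ge (by omega)]

theorem isCode_canon (w : Perm (Fin m)) : IsCode (canon w) := (isCanonical_canon w).1

theorem canon_eq {w : Perm (Fin m)} (h : IsCanonical w c) : canon w = c :=
  (existsUnique_isCanonical w).unique (isCanonical_canon w) h

theorem canon_injective : Function.Injective (canon : Perm (Fin m) → ℕ → ℕ) := by
  intro v w h
  rw [(isCanonical_canon v).2.2, (isCanonical_canon w).2.2, h]

theorem word_map_val (w : Perm (Fin m)) : (word w).map Fin.val = insWord (canon w) m := by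
  apply List.ext_getElem
  · simp [word]
  · intro i h1 h2
    simp only [length_insWord] at h2
    have := genProd_presWord_val (isCode_canon w) m le_rfl ⟨i, h2⟩
    rw [← (isCanonical_canon w).2.2, List.getD_eq_getElem _ _ (by simpa)] at this
    simpa [word] using this

theorem letter_eq (w : Perm (Fin m)) {i : ℕ} (h1 : 1 ≤ i) (h2 : i ≤ m) (d : ℕ) :
    letter w i = (insWord (canon w) m).getD (i - 1) d + 1 := by
  rw [letter, dif_pos ⟨h1, h2⟩, List.getD_eq_getElem _ _ (by simp; omega)]
  simp [← word_map_val, word]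

/-! ### Relative order of letters -/

theorem pair_sublist_insWord_succ {k a b : ℕ} (ha : a < k) (hb : b < k) :
    [a, b].Sublist (insWord c (k + 1)) ↔ [a, b].Sublist (insWord c k) := by
  rw [← pair_sublist_filter (fun y => decide (y ≠ k)) a b (by simp; omega) (by simp; omega),
    insWord_succ]
  have h : (insWord c k).filter (fun y => decide (y ≠ k)) = insWord c k :=
    List.filter_eq_self.2 fun y hy => by
      have := (mem_insWord c k y).1 hy
      simp; omega
  rw [List.filter_append, List.filter_cons_of_neg (by simp), ← List.filter_append,
    List.take_append_drop, h]

theorem pair_sublist_insWord {k l a b : ℕ} (hkl : k ≤ l) (ha : a < k) (hb : b < k) :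
    [a, b].Sublist (insWord c l) ↔ [a, b].Sublist (insWord c k) := by
  induction l, hkl using Nat.le_induction with
  | base => rfl
  | succ l hl ih => rw [pair_sublist_insWord_succ (by omega) (by omega), ih]

theorem pair_sublist_append_cons {α : Type*} {a b : α} {l l' : List α} (h1 : b ∉ l) (h2 : b ∉ l') :
    [a, b].Sublist (l ++ b :: l') ↔ a ∈ l := by
  induction l with
  | nil =>
    simp only [List.nil_append, List.not_mem_nil, iff_false, List.sublist_cons_iff]
    rintro (h | ⟨r, h, h'⟩)
    · exact h2 (h.subset (by simp))
    · simp only [List.cons.injEq] at h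
      rw [← h.2] at h'
      exact h2 (h'.subset (by simp))
  | cons x l ih =>
    simp only [List.mem_cons, not_or] at h1
    rw [List.cons_append, List.sublist_cons_iff, ih h1.2, List.mem_cons, or_comm]
    refine or_congr ?_ Iff.rfl
    constructor
    · rintro ⟨r, h, _⟩
      simp only [List.cons.injEq] at h
      exact h.1
    · rintro rfl
      exact ⟨[b], rfl, by simp⟩

/-- Letters inserted after `k` do not affect the order of smaller ones, and when `k` is inserted
exactly the first `c k - 1` letters precede it. -/
theorem pair_sublist_max_insWord {k l a : ℕ} (hkl : k < l) :
    (a < k ∧ [a, k].Sublist (insWord c l)) ↔ a ∈ (insWord c k).take (c k - 1) := by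
  have hk : k ∉ insWord c k := by simp [mem_insWord]
  rw [← pair_sublist_append_cons (b := k) (l' := (insWord c k).drop (c k - 1))
    (fun h => hk (List.mem_of_mem_take h)) (fun h => hk (List.mem_of_mem_drop h)), ← insWord_succ]
  constructor
  · rintro ⟨h, h'⟩
    exact (pair_sublist_insWord hkl (by omega) (by omega)).1 h'
  · intro h
    have h1 : a < k + 1 := (mem_insWord c _ _).1 (h.subset (by simp))
    refine ⟨?_, (pair_sublist_insWord hkl (by omega) (by omega)).2 h⟩
    by_contra hcon
    have e : a = k := by omega
    have := (nodup_insWord c (k + 1)).sublist h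
    simp [e] at this

theorem card_before_insWord (hc : IsCode c) {k l : ℕ} (hkl : k < l) :
    #{a ∈ Finset.range k | [a, k].Sublist (insWord c l)} = c k - 1 := by
  have e : {a ∈ Finset.range k | [a, k].Sublist (insWord c l)} =
      ((insWord c k).take (c k - 1)).toFinset := by
    ext a
    rw [Finset.mem_filter, Finset.mem_range, pair_sublist_max_insWord hkl, List.mem_toFinset]
  have := hc k
  rw [e, List.toFinset_card_of_nodup ((nodup_insWord c k).sublist (List.take_sublist _ _))]
  simp
  omega

theorem not_pair_sublist_iff_code_eq_one (hc : IsCode c) {k l : ℕ} (hkl : k < l) :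
    (∀ a < k, ¬ [a, k].Sublist (insWord c l)) ↔ c k = 1 := by
  have h1 := card_before_insWord hc hkl
  have h2 := hc k
  rw [show c k = 1 ↔ c k - 1 = 0 by omega, ← h1, Finset.card_eq_zero,
    Finset.filter_eq_empty_iff]
  simp

theorem pair_sublist_succ_iff_code (hc : IsCode c) {k l : ℕ} (hkl : k + 1 < l) :
    [k, k + 1].Sublist (insWord c l) ↔ c k < c (k + 1) := by
  have h := pair_sublist_max_insWord (c := c) (a := k) hkl
  have h1 := hc k
  have h2 := hc (k + 1)
  -- Just before `k + 1` is inserted, `k` still has 0-based position `c k - 1`; it precedes `k + 1`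
  -- when it lies among the first `c (k + 1) - 1` letters.
  have hk1 : (insWord c (k + 1)).getD (c k - 1) 0 = k := getD_insWord_self hc _ rfl
  rw [show [k, k + 1].Sublist (insWord c l) ↔ (k < k + 1 ∧ [k, k + 1].Sublist (insWord c l)) by simp,
    h, List.mem_take_iff_getElem]
  rw [List.getD_eq_getElem _ _ (by simp; omega)] at hk1
  constructor
  · rintro ⟨i, hi, e⟩
    have := (List.Nodup.getElem_inj_iff (nodup_insWord c (k + 1))).1 (e.trans hk1.symm)
    omega
  · intro h
    exact ⟨c k - 1, by simp; omega, hk1⟩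

/-! ### Inversions -/

/-- The new largest letter `k` forms inversions exactly with the `k + 1 - c k` letters to its right.
-/
theorem coinv_reverse_insWord (hc : IsCode c) (k : ℕ) :
    coinv (insWord c k).reverse = ∑ j ∈ Finset.range k, (j + 1 - c j) := by
  induction k with
  | zero => rfl
  | succ k ih =>
    have h := hc k
    rw [Finset.sum_range_succ, ← ih, insWord_succ]
    conv_rhs => rw [← List.take_append_drop (c k - 1) (insWord c k)]
    simp only [List.reverse_append, List.reverse_cons, List.append_assoc, List.singleton_append]
    rw [coinv_append, coinv_append]
    have h1 : ((insWord c k).take (c k - 1)).reverse.countP (fun y => decide (k ≤ y)) = 0 :=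
      List.countP_eq_zero.2 fun y hy => by
        simpa [mem_insWord] using List.mem_of_mem_take (List.mem_reverse.1 hy)
    have h2 : crossLe ((insWord c k).drop (c k - 1)).reverse [k] = k + 1 - c k := by
      rw [crossLe_singleton, List.countP_eq_length.2]
      · simp; omega
      · intro y hy
        have := (mem_insWord c k y).1 (List.mem_of_mem_drop (List.mem_reverse.1 hy))
        simp; omega
    have h3 : ∀ A B : List ℕ, crossLe A (k :: B) = crossLe A [k] + crossLe A B := by
      intro A B
      simp only [crossLe, ← List.sum_map_add]
      congr 1
      exact List.map_congr_left fun x _ => by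
        rw [← List.countP_append, List.singleton_append]
    rw [h3, h2, coinv, h1]
    ring

end Insertion

/-! ### The codes of `f_q(v)` and `g_{q,u}(w)` -/

section Codes

theorem run_append {j i l : ℕ} (h1 : l ≤ i + 1) (h2 : i ≤ j) :
    run j (i + 1) ++ run i l = run j l := by
  simp only [run, ← List.reverse_append]
  have := List.range'_append_1 (s := l) (m := i + 1 - l) (n := j + 1 - (i + 1))
  rw [show l + (i + 1 - l) = i + 1 by omega,
    show i + 1 - l + (j + 1 - (i + 1)) = j + 1 - l by omega] at this
  rw [this]

theorem run_map_add (j l t : ℕ) : (run j l).map (fun i => i + t) = run (j + t) (l + t) := by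
  have := List.map_add_range' (a := t) (s := l) (n := j + 1 - l) (step := 1)
  simp only [run, List.map_reverse, show j + t + 1 - (l + t) = j + 1 - l by omega]
  rw [Nat.add_comm l t, ← this]
  simp only [Nat.add_comm _ t]

theorem le_of_mem_run {j l i : ℕ} (h : i ∈ run j l) : l ≤ i := by
  simp [run, List.mem_range'_1] at h; omega

theorem prod_map_eq_one {M α : Type*} [Monoid M] (L : List α) (f : α → M) (h : ∀ i ∈ L, f i = 1) :
    (L.map f).prod = 1 :=
  List.prod_eq_one fun x hx => by
    obtain ⟨i, hi, rfl⟩ := List.mem_map.1 hx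
    exact h i hi

/-- The code of `f_q(v)`, in terms of that of `v`. -/
def downCode (q : ℕ) (c : ℕ → ℕ) (i : ℕ) : ℕ := max (c (i + q - 1) - (q - 1)) 1

variable {n q : ℕ}

/-- Split the run at `q - 1`: the lower part is sent to 1, the upper part is shifted. All runs with
`l ≤ q` thus have the same image, whence the maximum with 1. -/
theorem prod_run_down (hq : 1 ≤ q) (k l : ℕ) :
    ((run (k + q) l).map fun j => if j < q then 1 else gen n (j - q + 1)).prod =
      genProd n (run (k + 1) (max (l - (q - 1)) 1)) := by
  have key : ∀ t, 1 ≤ t → ((run (k + q) (t + (q - 1))).map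
      fun j => if j < q then 1 else gen n (j - q + 1)).prod = genProd n (run (k + 1) t) := by
    intro t ht
    rw [show k + q = k + 1 + (q - 1) by omega, ← run_map_add, List.map_map, genProd]
    congr 1
    refine List.map_congr_left fun i hi => ?_
    have := le_of_mem_run hi
    simp only [Function.comp]
    rw [if_neg (by omega)]
    congr 1
    omega
  rcases le_or_gt q l with h | h
  · have := key (l - (q - 1)) (by omega)
    rw [show l - (q - 1) + (q - 1) = l by omega] at this
    rw [this, max_eq_left (by omega)]
  · rw [← run_append (i := q - 1) (by omega) (by omega), List.map_append, List.prod_append,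
      prod_map_eq_one (run (q - 1) l), mul_one, max_eq_right (by omega), ← key 1 le_rfl]
    · rw [Nat.add_comm 1]
    · intro i hi
      have := mem_run hi
      rw [if_pos (by omega)]

theorem isCode_downCode {c : ℕ → ℕ} (hq : 1 ≤ q) (hc : IsCode c) : IsCode (downCode q c) := by
  intro j
  have := hc (j + q - 1)
  simp only [downCode]
  omega

theorem canon_fMap (hn : 1 ≤ n) (hq : 1 ≤ q) (v : Perm (Fin (n + q - 1))) :
    canon (fMap n q v) = downCode q (canon v) := by
  have hc := isCode_canon v
  refine canon_eq ⟨isCode_downCode hq hc, fun j hj => ?_, ?_⟩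
  · have := (isCanonical_canon v).2.1 (j + q - 1) (by omega)
    simp only [downCode]
    omega
  · have key : ∀ k, ((presWord (k + q) (canon v)).map
        fun j => if j < q then 1 else gen n (j - q + 1)).prod =
          genProd n (presWord (k + 1) (downCode q (canon v))) := by
      intro k
      induction k with
      | zero =>
        rw [prod_map_eq_one]
        · simp [presWord, genProd]
        · intro i hi
          rw [if_pos (by simpa using mem_presWord hi)]
      | succ k ih =>
        have h2 := (hc (k + q)).2
        rw [show k + 1 + q = k + q + 1 by omega, presWord_succ _ (by omega), List.map_append,
          List.prod_append, ih, prod_run_down hq k, presWord_succ (k + 1) (by omega),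
          genProd_append]
        simp only [downCode]
        rw [show k + 1 + q - 1 = k + q by omega]
    have := key (n - 1)
    rw [show n - 1 + q = n + q - 1 by omega, show n - 1 + 1 = n by omega] at this
    rw [fMap, canonWord, this]

theorem genProd_flatMap {α : Type*} (m : ℕ) (L : List α) (f : α → List ℕ) :
    genProd m (L.flatMap f) = (L.map fun a => genProd m (f a)).prod := by
  induction L with
  | nil => simp [genProd]
  | cons a L ih => rw [List.flatMap_cons, genProd_append, ih, List.map_cons, List.prod_cons]

/-- The code of `g_{q,u}(w)`, in terms of those of `u` and `w`. -/
def upCode (q : ℕ) (c e : ℕ → ℕ) (j : ℕ) : ℕ :=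
  if j < q ∨ e (j - (q - 1)) = 1 then c j else e (j - (q - 1)) + (q - 1)

theorem canon_gMap (hn : 1 ≤ n) (hq : 1 ≤ q) (u : Perm (Fin (n + q - 1))) (w : Perm (Fin n)) :
    canon (gMap n q u w) = upCode q (canon u) (canon w) := by
  have hc := isCode_canon u
  have he := isCode_canon w
  refine canon_eq ⟨fun j => ?_, fun j hj => ?_, ?_⟩
  · have h1 := hc j
    have h2 := he (j - (q - 1))
    simp only [upCode]
    split_ifs <;> omega
  · have h1 := (isCanonical_canon u).2.1 j hj
    simp only [upCode]
    split_ifs with h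
    · exact h1
    · rw [not_or] at h
      have h2 := (isCanonical_canon w).2.1 (j - (q - 1)) (by omega)
      omega
  · have e := List.range'_append_1 (s := 1) (m := q - 1) (n := n - 1)
    rw [presWord, show n + q - 1 - 1 = q - 1 + (n - 1) by omega, ← e, List.flatMap_append,
      genProd_append, genProd_flatMap, genProd_flatMap, gMap]
    congr 2
    · refine List.map_congr_left fun j hj => ?_
      rw [List.mem_range'_1] at hj
      rw [factor, upCode, if_pos (Or.inl (by omega))]
    · rw [show 1 + (q - 1) = (q - 1) + 1 by omega, ← List.map_add_range', List.map_map]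
      refine List.map_congr_left fun j hj => ?_
      rw [List.mem_range'_1] at hj
      simp only [Function.comp, gFactor, upCode]
      rw [show q - 1 + j - (q - 1) = j by omega, show j + q - 1 = q - 1 + j by omega]
      by_cases h : canon w j = 1
      · rw [if_pos h, if_pos (Or.inr h), factor]
      · rw [if_neg h, if_neg (by omega)]
        congr 2
        omega

/-! ### The `q`-length -/

theorem countP_run (hq : 1 ≤ q) (k l : ℕ) (hl : l ≤ k + q + 1) :
    (run (k + q) l).countP (fun i => decide (q ≤ i)) = k + 2 - max (l - (q - 1)) 1 := by
  have key : ∀ l, q ≤ l → (run (k + q) l).countP (fun i => decide (q ≤ i)) = k + q + 1 - l := by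
    intro l hl
    rw [List.countP_eq_length.2 fun i hi => by simpa using hl.trans (le_of_mem_run hi)]
    simp [run]
  rcases le_or_gt q l with h | h
  · rw [key l h]
    omega
  · rw [← run_append (i := q - 1) (by omega) (by omega), List.countP_append, key _ (by omega),
      List.countP_eq_zero.2 fun i hi => by have := mem_run hi; simp; omega]
    omega

theorem qLength_eq_sum (hn : 1 ≤ n) (hq : 1 ≤ q) (v : Perm (Fin (n + q - 1))) :
    qLength q v = ∑ i ∈ Finset.range n, (i + 1 - canon (fMap n q v) i) := by
  have hc := isCode_canon v
  have key : ∀ k, (presWord (k + q) (canon v)).countP (fun i => decide (q ≤ i)) =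
      ∑ i ∈ Finset.range (k + 1), (i + 1 - downCode q (canon v) i) := by
    intro k
    induction k with
    | zero =>
      rw [List.countP_eq_zero.2 fun i hi => by have := mem_presWord hi; simp; omega]
      simp [downCode]
    | succ k ih =>
      have h2 := (hc (k + q)).2
      rw [show k + 1 + q = k + q + 1 by omega, presWord_succ _ (by omega), List.countP_append, ih,
        countP_run hq k _ (by omega), Finset.sum_range_succ _ (k + 1)]
      simp only [downCode]
      rw [show k + 1 + q - 1 = k + q by omega]
  have := key (n - 1)
  rw [show n - 1 + q = n + q - 1 by omega, show n - 1 + 1 = n by omega] at this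
  rw [qLength, canonWord, this, canon_fMap hn hq]

end Codes

/-! ### The statistics of `v⁻¹` -/

section Inverse

theorem pair_sublist_or {α : Type*} {a b : α} {l : List α} (ha : a ∈ l) (hb : b ∈ l) (hab : a ≠ b) :
    [a, b].Sublist l ∨ [b, a].Sublist l := by
  induction l with
  | nil => simp at ha
  | cons x l ih =>
    rcases List.mem_cons.1 ha with rfl | ha'
    · exact Or.inl (List.cons_sublist_cons.2
        (List.singleton_sublist.2 ((List.mem_cons.1 hb).resolve_left hab.symm)))
    · rcases List.mem_cons.1 hb with rfl | hb'
      · exact Or.inr (List.cons_sublist_cons.2 (List.singleton_sublist.2 ha'))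
      · exact (ih ha' hb').imp (fun h => h.cons _) fun h => h.cons _

variable {m : ℕ}

theorem mem_word (v : Perm (Fin m)) (a : Fin m) : a ∈ word v := by
  rw [word, List.mem_ofFn]
  exact v.surjective a

theorem pair_sublist_word (v : Perm (Fin m)) (a b : Fin m) :
    [a, b].Sublist (word v) ↔ v⁻¹ a < v⁻¹ b := by
  have hp : (word v).Pairwise fun x y => v⁻¹ x < v⁻¹ y := by
    rw [word, List.pairwise_ofFn]
    intro i j hij
    simpa using hij
  have key : ∀ a b : Fin m, [a, b].Sublist (word v) → v⁻¹ a < v⁻¹ b := fun a b h => by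
    simpa using hp.sublist h
  refine ⟨key a b, fun h => ?_⟩
  refine (pair_sublist_or (mem_word v a) (mem_word v b) ?_).resolve_right fun h' =>
    lt_asymm h (key b a h')
  rintro rfl
  exact lt_irrefl _ h

theorem pair_sublist_insWord_canon (v : Perm (Fin m)) (a b : Fin m) :
    [a.val, b.val].Sublist (insWord (canon v) m) ↔ [a, b].Sublist (word v) := by
  rw [← word_map_val, List.sublist_map_iff]
  constructor
  · rintro ⟨l, hl, h⟩
    rw [show [a.val, b.val] = [a, b].map Fin.val from rfl] at h
    rwa [List.map_injective_iff.2 Fin.val_injective h]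
  · intro h
    exact ⟨[a, b], h, rfl⟩

theorem letter_inv_lt (v : Perm (Fin m)) {a b : ℕ} (ha : a < m) (hb : b < m) :
    letter v⁻¹ (a + 1) < letter v⁻¹ (b + 1) ↔ [a, b].Sublist (insWord (canon v) m) := by
  rw [letter, letter, dif_pos (by omega), dif_pos (by omega),
    pair_sublist_insWord_canon v ⟨a, ha⟩ ⟨b, hb⟩, pair_sublist_word]
  simp

theorem mem_qDel_inv (q : ℕ) (v : Perm (Fin m)) (j : ℕ) :
    j ∈ qDel q v⁻¹ ↔ (q < j ∧ j ≤ m) ∧ canon v (j - 1) ≤ q := by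
  rw [qDel, Finset.mem_filter, Finset.mem_Icc, Nat.succ_le_iff]
  refine and_congr_right fun ⟨h1, h2⟩ => ?_
  obtain ⟨k, rfl⟩ : ∃ k, j = k + 1 := ⟨j - 1, by omega⟩
  have h := card_before_insWord (isCode_canon v) (k := k) (l := m) (by omega)
  have e : #{i ∈ Finset.Ico 1 (k + 1) | letter v⁻¹ i < letter v⁻¹ (k + 1)} =
      #{a ∈ Finset.range k | [a, k].Sublist (insWord (canon v) m)} := by
    rw [← Finset.card_map (s := {a ∈ Finset.range k | [a, k].Sublist (insWord (canon v) m)})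
      (addRightEmbedding 1)]
    congr 1
    ext i
    simp only [Finset.mem_filter, Finset.mem_Ico, Finset.mem_map, Finset.mem_range,
      addRightEmbedding_apply]
    constructor
    · rintro ⟨h3, h4⟩
      obtain ⟨a, rfl⟩ : ∃ a, i = a + 1 := ⟨i - 1, by omega⟩
      exact ⟨a, ⟨by omega, (letter_inv_lt v (by omega) (by omega)).1 h4⟩, rfl⟩
    · rintro ⟨a, ⟨h3, h4⟩, rfl⟩
      exact ⟨by omega, (letter_inv_lt v (by omega) (by omega)).2 h4⟩
  have := isCode_canon v k
  rw [e, h, Nat.add_sub_cancel]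
  omega

theorem not_pair_sublist_insWord {c : ℕ → ℕ} {a b : ℕ} (ha : a < m) (hb : b < m) (hab : a ≠ b) :
    [b, a].Sublist (insWord c m) ↔ ¬ [a, b].Sublist (insWord c m) := by
  refine ⟨fun h h' => ?_, fun h =>
    (pair_sublist_or ((mem_insWord c m a).2 ha) ((mem_insWord c m b).2 hb) hab).resolve_left h⟩
  have hp := nodup_insWord c m
  rw [List.cons_sublist_iff] at h
  obtain ⟨r₁, r₂, e, h1, h2⟩ := h
  rw [e] at hp h'
  rw [List.singleton_sublist] at h2
  have hd := (List.nodup_append.1 hp).2.2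
  have h3 : b ∉ r₂ := fun h => hd b h1 b h rfl
  have h4 : a ∉ r₁ := fun h => hd a h a h2 rfl
  rw [List.cons_sublist_iff] at h'
  obtain ⟨s₁, s₂, e', h5, h6⟩ := h'
  rw [List.singleton_sublist] at h6
  rcases List.append_eq_append_iff.1 e' with ⟨t, rfl, rfl⟩ | ⟨t, rfl, rfl⟩
  · exact h3 (by simp [h6])
  · exact h4 (by simp [h5])

theorem mem_qDes_inv {n q : ℕ} (hn : 1 ≤ n) (hq : 1 ≤ q) (v : Perm (Fin (n + q - 1))) (i : ℕ) :
    i ∈ qDes q v⁻¹ ↔ (q ≤ i ∧ i ≤ n + q - 1 - 1) ∧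
      canon (fMap n q v) (i - q + 1) ≤ canon (fMap n q v) (i - q) := by
  rw [qDes, Finset.mem_filter, Finset.mem_Icc]
  refine and_congr_right fun ⟨h1, h2⟩ => ?_
  rw [mem_qDel_inv, descents, Finset.mem_filter, Finset.mem_Icc, canon_fMap hn hq]
  obtain ⟨k, rfl⟩ : ∃ k, i = k + q := ⟨i - q, by omega⟩
  have h3 := letter_inv_lt v (a := k + q) (b := k + q - 1) (by omega) (by omega)
  have h4 := pair_sublist_succ_iff_code (isCode_canon v) (k := k + q - 1) (l := n + q - 1) (by omega)
  rw [not_pair_sublist_insWord (by omega) (by omega) (by omega),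
    show [k + q - 1, k + q] = [k + q - 1, k + q - 1 + 1] by congr 2; omega, h4] at h3
  rw [show k + q - 1 + 1 = k + q by omega] at h3
  rw [h3]
  simp only [downCode, Nat.add_sub_cancel]
  rw [show k + 1 + q - 1 = k + q by omega]
  -- Truncation at 1 makes the lowered inequality equivalent to `c i ≤ c (i - 1)` or `c i ≤ q`, the
  -- two ways of being in `Des_q(v⁻¹)`.
  omega

end Inverse

/-! ### The `q`-descents of `v` -/

section Descents

variable {n q : ℕ}

theorem countP_take_insert {α : Type*} (p : α → Bool) (L : List α) (x : α) (i j : ℕ) (hij : i ≤ j)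
    (hi : i ≤ L.length) (hx : p x = false) :
    ((L.take i ++ x :: L.drop i).take (j + 1)).countP p = (L.take j).countP p := by
  obtain ⟨d, rfl⟩ := Nat.exists_eq_add_of_le hij
  rw [List.take_append, List.length_take, min_eq_left hi, List.take_of_length_le (by simp; omega),
    show i + d + 1 - i = d + 1 by omega, List.take_succ_cons, List.take_add]
  simp [hx]

theorem take_insert {α : Type*} (L : List α) (x : α) (i j : ℕ) (hij : j ≤ i) (hi : i ≤ L.length) :
    (L.take i ++ x :: L.drop i).take j = L.take j := by
  rw [List.take_append_of_le_length (by simp; omega), List.take_take, min_eq_left hij]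

/-- The `q`-descents of an insertion word at positions `≥ q` are the descents of the word obtained
from the lowered code. -/
theorem qDescent_insWord (hq : 1 ≤ q) {c : ℕ → ℕ} (hc : IsCode c) (k i : ℕ) (hi : i < k) :
    ((insWord c (k + q)).getD (i + q) 0 < (insWord c (k + q)).getD (i + q - 1) 0 ∨
      ((insWord c (k + q)).take (i + q)).countP
        (fun y => decide (y < (insWord c (k + q)).getD (i + q) 0)) < q) ↔
    (insWord (downCode q c) (k + 1)).getD (i + 1) 0 <
      (insWord (downCode q c) (k + 1)).getD i 0 := by
  induction k generalizing i with
  | zero => omega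
  | succ k ih =>
    have hd := isCode_downCode hq hc
    have hcp := hc (k + q)
    have hdp : downCode q c (k + 1) - 1 = c (k + q) - 1 - (q - 1) := by
      simp only [downCode]
      rw [show k + 1 + q - 1 = k + q by omega]
      omega
    have hL : ∀ x, (insWord c (k + q)).getD x 0 < k + q ∨ k + q ≤ x := fun x =>
      (lt_or_ge x (k + q)).imp_left fun h => getD_insWord_lt 0 h
    have hF : ∀ x, (insWord (downCode q c) (k + 1)).getD x 0 < k + 1 ∨ k + 1 ≤ x := fun x =>
      (lt_or_ge x (k + 1)).imp_left fun h => getD_insWord_lt 0 h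
    rw [show k + 1 + q = k + q + 1 by omega]
    -- Induction on the largest letter, inserted at 0-based place `p = c (k + q) - 1` above and at
    -- the truncated difference `p - (q - 1)` below. If the lower place is beyond `i + 1`, neither
    -- pair changes.
    rcases lt_trichotomy (i + 1) (c (k + q) - 1 - (q - 1)) with h | h | h
    · rw [getD_insWord_of_lt (k := k + 1) hd 0 0 (by omega), getD_insWord_of_lt (k := k + 1) hd 0 0 (by omega),
        getD_insWord_of_lt (k := k + q) hc 0 0 (by omega), getD_insWord_of_lt (k := k + q) hc 0 0 (by omega), insWord_succ c,
        take_insert _ _ _ _ (by omega) (by simp; omega)]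
      exact ih i (by omega)
    -- The new letter is second in both pairs: no descent, and all of its `i + q ≥ q` predecessors
    -- are smaller.
    · rw [getD_insWord_of_lt (k := k + 1) hd (x := i) 0 0 (by omega),
        getD_insWord_self (k := k + 1) hd (x := i + 1) 0 (by omega),
        getD_insWord_self (k := k + q) hc (x := i + q) 0 (by omega),
        getD_insWord_of_lt (k := k + q) hc 0 0 (by omega), insWord_succ c,
        take_insert _ _ _ _ (by omega) (by simp; omega), List.countP_eq_length.2]
      · have h1 := hL (i + q - 1)
        have h2 := hF i
        rw [List.length_take, length_insWord]
        omega
      · intro y hy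
        simpa [mem_insWord] using List.mem_of_mem_take hy
    · rw [getD_insWord_of_gt (k := k + 1) hd (x := i + 1) 0 0 (by omega) (by omega),
        getD_insWord_of_gt (k := k + q) hc (x := i + q) 0 0 (by omega) (by omega), Nat.add_sub_cancel]
      have h1 := hL (i + q - 1)
      have h2 := hF i
      rcases Nat.eq_or_lt_of_le (show c (k + q) - 1 - (q - 1) ≤ i by omega) with h3 | h3
      · rw [getD_insWord_self (k := k + 1) hd (x := i) 0 (by omega)]
        refine iff_of_true ?_ (by omega)
        -- The new letter is first in the lower pair, a descent. If truncation occurred, then `i =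
        -- 0`, and the upper letter at place `q` has the new maximum among its `q` predecessors,
        -- hence fewer than `q` smaller ones; otherwise there is a true descent above.
        rcases Nat.lt_or_ge (c (k + q) - 1) (q - 1) with h4 | h4
        · right
          obtain rfl : i = 0 := by omega
          have := countP_take_insert
            (fun y => decide (y < (insWord c (k + q)).getD (0 + q - 1) 0)) (insWord c (k + q))
            (k + q) (c (k + q) - 1) (q - 1) (by omega) (by simp; omega)
            (decide_eq_false (by omega))
          rw [show 0 + q = q - 1 + 1 by omega, insWord_succ c, show q - 1 + 1 = 0 + q by omega]
          rw [show q - 1 + 1 = 0 + q by omega] at this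
          rw [this]
          refine List.countP_le_length.trans_lt ?_
          simp
          omega
        · left
          rw [getD_insWord_self (k := k + q) hc (x := i + q - 1) 0 (by omega)]
          omega
      · rw [getD_insWord_of_gt (k := k + 1) hd (x := i) 0 0 (by omega) (by omega),
          getD_insWord_of_gt (k := k + q) hc (x := i + q - 1) 0 0 (by omega) (by omega)]
        have := countP_take_insert
          (fun y => decide (y < (insWord c (k + q)).getD (i + q - 1) 0)) (insWord c (k + q))
          (k + q) (c (k + q) - 1) (i + q - 1) (by omega) (by simp; omega)
            (decide_eq_false (by omega))
        rw [show i + q - 1 + 1 = i + q by omega] at this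
        rw [insWord_succ c, this]
        have := ih (i - 1) (by omega)
        rwa [show i - 1 + q = i + q - 1 by omega, show i - 1 + 1 = i by omega] at this

variable {m : ℕ}

theorem card_smaller_letters (v : Perm (Fin m)) (y j : ℕ) (hj : j ≤ m) :
    #{i ∈ Finset.Ico 1 (j + 1) | letter v i < y + 1} =
      ((insWord (canon v) m).take j).countP fun z => decide (z < y) := by
  induction j with
  | zero => simp
  | succ j ih =>
    rw [← Finset.insert_Ico_right_eq_Ico_add_one (by omega), Finset.filter_insert, List.take_add_one,
      List.countP_append, ← ih (by omega), letter_eq v (by omega) hj 0, Nat.add_sub_cancel,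
      List.getD_eq_getElem _ _ (by simp; omega), List.getElem?_eq_getElem (by simp; omega)]
    split_ifs with h
    · rw [Finset.card_insert_of_notMem (by simp)]
      simp at h ⊢
      omega
    · simp at h ⊢
      omega

theorem mem_qDes (hn : 1 ≤ n) (hq : 1 ≤ q) (v : Perm (Fin (n + q - 1))) (i : ℕ) :
    i ∈ qDes q v ↔ (q ≤ i ∧ i ≤ n + q - 1 - 1) ∧
      (insWord (canon (fMap n q v)) n).getD (i - q + 1) 0 <
        (insWord (canon (fMap n q v)) n).getD (i - q) 0 := by
  rw [qDes, Finset.mem_filter, Finset.mem_Icc]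
  refine and_congr_right fun ⟨h1, h2⟩ => ?_
  obtain ⟨k, rfl⟩ : ∃ k, i = k + q := ⟨i - q, by omega⟩
  obtain ⟨n, rfl⟩ : ∃ n', n = n' + 1 := ⟨n - 1, by omega⟩
  have key := qDescent_insWord hq (isCode_canon v) n k (by omega)
  rw [Nat.add_sub_cancel, canon_fMap hn hq, ← key, descents, qDel, Finset.mem_filter,
    Finset.mem_filter, Finset.mem_Icc, Finset.mem_Icc, letter_eq v (i := k + q + 1) (by omega) (by omega) 0,
    letter_eq v (i := k + q) (by omega) (by omega) 0, card_smaller_letters v _ _ (by omega),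
    Nat.add_sub_cancel]
  simp only [show n + 1 + q - 1 = n + q by omega]
  rw [and_iff_right (by omega), and_iff_right (by omega)]
  omega

theorem rmajWord_eq_sum (l : List ℕ) (hl : l.Nodup) :
    rmajWord l = ∑ i ∈ Finset.range (l.length - 1),
      if l.getD (i + 1) 0 < l.getD i 0 then l.length - 1 - i else 0 := by
  induction l with
  | nil => rfl
  | cons x l ih =>
    rw [List.nodup_cons] at hl
    rw [rmajWord, ih hl.2]
    cases l with
    | nil => simp
    | cons y l =>
      have hxy : x ≠ y := fun h => hl.1 (by simp [h])
      rw [show (x :: y :: l).length - 1 = (y :: l).length - 1 + 1 by simp, Finset.sum_range_succ']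
      congr 1
      · refine Finset.sum_congr rfl fun i _ => ?_
        rw [List.getD_cons_succ (xs := y :: l), List.getD_cons_succ (xs := y :: l), Nat.add_sub_add_right]
      · simp [lt_iff_le_and_ne, hxy.symm]

theorem qRmaj_eq (hn : 1 ≤ n) (hq : 1 ≤ q) (v : Perm (Fin (n + q - 1))) :
    qRmaj q v = rmajWord (insWord (canon (fMap n q v)) n) := by
  rw [rmajWord_eq_sum _ (nodup_insWord _ _), ← Finset.sum_filter, qRmaj, length_insWord]
  refine Finset.sum_bij' (fun i _ => i - q) (fun i _ => i + q) ?_ ?_ ?_ ?_ ?_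
  · intro i hi
    rw [mem_qDes hn hq] at hi
    rw [Finset.mem_filter, Finset.mem_range]
    exact ⟨by omega, hi.2⟩
  · intro i hi
    rw [Finset.mem_filter, Finset.mem_range] at hi
    rw [mem_qDes hn hq, Nat.add_sub_cancel]
    exact ⟨by omega, hi.2⟩
  · intro i hi
    rw [mem_qDes hn hq] at hi
    omega
  · intro i hi
    omega
  · intro i hi
    rw [mem_qDes hn hq] at hi
    omega

end Descents

/-! ### The right-to-left Foata transformation -/

section Rtl

variable {m : ℕ}

theorem word_rev (v : Perm (Fin m)) : word (rev v) = (word v).reverse := by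
  apply List.ext_getElem
  · simp [word]
  · intro i h1 h2
    simp only [word, rev, List.getElem_ofFn, List.getElem_reverse, Perm.mul_apply, List.length_ofFn]
    congr 1
    ext
    simp
    omega

theorem word_rtlFoata (w : Perm (Fin m)) :
    word (rtlFoata w) = (foataWord (word w).reverse).reverse := by
  rw [rtlFoata, word_rev, word_foata, word_rev]

theorem word_injective : Function.Injective (word : Perm (Fin m) → List (Fin m)) := by
  intro v w h
  ext i
  rw [List.ofFn_injective h]

theorem rtlFoata_injective : Function.Injective (rtlFoata : Perm (Fin m) → Perm (Fin m)) := by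
  intro v w h
  have := congrArg word h
  rw [word_rtlFoata, word_rtlFoata] at this
  exact word_injective (List.reverse_injective
    (foataWord_injective (List.reverse_injective this)))

theorem nodup_word (w : Perm (Fin m)) : (word w).Nodup := List.nodup_ofFn.2 w.injective

theorem coinv_map {l : List (Fin m)} : coinv (l.map Fin.val) = coinv l := by
  induction l with
  | nil => rfl
  | cons x l ih =>
    rw [List.map_cons, coinv, coinv, ih, List.countP_map]
    rfl

theorem rmajWord_map {l : List (Fin m)} : rmajWord (l.map Fin.val) = rmajWord l := by
  induction l with
  | nil => rfl
  | cons x l ih =>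
    rw [List.map_cons, rmajWord, rmajWord, ih]
    simp

theorem sum_code_rtlFoata (w : Perm (Fin m)) :
    ∑ i ∈ Finset.range m, (i + 1 - canon (rtlFoata w) i) = rmajWord (insWord (canon w) m) := by
  rw [← coinv_reverse_insWord (isCode_canon _), ← word_map_val, ← word_map_val, ← List.map_reverse,
    coinv_map, rmajWord_map, word_rtlFoata, List.reverse_reverse, coinv_foataWord_reverse]

theorem pair_sublist_reverse {α : Type*} (a b : α) (l : List α) :
    [a, b].Sublist l.reverse ↔ [b, a].Sublist l := by
  rw [← List.reverse_sublist, List.reverse_reverse]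
  rfl

theorem canon_rtlFoata_eq_one (w : Perm (Fin m)) {k : ℕ} (hk : k < m) :
    canon (rtlFoata w) k = 1 ↔ canon w k = 1 := by
  -- A letter with code 1 has no smaller letter to its left, so it is a right-to-left minimum of the
  -- reversed word.
  have key : ∀ u : Perm (Fin m), canon u k = 1 ↔
      ∀ a ∈ (word w).reverse, a < ⟨k, hk⟩ → [a, ⟨k, hk⟩].Sublist (word u).reverse := by
    intro u
    rw [← not_pair_sublist_iff_code_eq_one (isCode_canon u) hk]
    simp only [pair_sublist_reverse]
    constructor
    · intro h a _ ha
      have := h a.val ha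
      rw [← not_pair_sublist_insWord a.isLt hk (Nat.ne_of_lt ha)] at this
      exact (pair_sublist_insWord_canon u ⟨k, hk⟩ a).1 this
    · intro h a ha
      rw [← not_pair_sublist_insWord (ha.trans hk) hk ha.ne]
      exact (pair_sublist_insWord_canon u ⟨k, hk⟩ ⟨a, ha.trans hk⟩).2
        (h ⟨a, _⟩ (List.mem_reverse.2 (mem_word w _)) ha)
  rw [key, key, word_rtlFoata, List.reverse_reverse]
  exact rtlMin_foataWord _ _ (List.nodup_reverse.2 (nodup_word w))

theorem canon_rtlFoata_le (w : Perm (Fin m)) {k : ℕ} (hk : k + 1 < m) :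
    canon (rtlFoata w) (k + 1) ≤ canon (rtlFoata w) k ↔ canon w (k + 1) ≤ canon w k := by
  have key : ∀ u : Perm (Fin m), canon u (k + 1) ≤ canon u k ↔
      [(⟨k, by omega⟩ : Fin m), ⟨k + 1, hk⟩].Sublist (word u).reverse := by
    intro u
    rw [← not_lt, ← pair_sublist_succ_iff_code (isCode_canon u) hk,
      ← not_pair_sublist_insWord (by omega) hk (by omega), pair_sublist_reverse]
    exact pair_sublist_insWord_canon u ⟨k + 1, hk⟩ ⟨k, by omega⟩
  rw [key, key, word_rtlFoata, List.reverse_reverse]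
  refine pair_sublist_foataWord _ _ (by simp) (fun z => ?_) _ (List.nodup_reverse.2 (nodup_word w))
  simp only [Fin.le_def]
  omega

end Rtl

/-! ### The map `Ψ_q` -/

section Psi

variable {n q : ℕ}

theorem canon_Psi (hn : 1 ≤ n) (hq : 1 ≤ q) (v : Perm (Fin (n + q - 1))) :
    canon (Psi n q v) = upCode q (canon v) (canon (rtlFoata (fMap n q v))) :=
  canon_gMap hn hq v _

theorem canon_rtlFoata_fMap_eq_one (hn : 1 ≤ n) (hq : 1 ≤ q) (v : Perm (Fin (n + q - 1))) {i : ℕ}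
    (hi : i < n) : canon (rtlFoata (fMap n q v)) i = 1 ↔ canon v (i + q - 1) ≤ q := by
  rw [canon_rtlFoata_eq_one _ hi, canon_fMap hn hq, downCode]
  omega

theorem fMap_Psi (hn : 1 ≤ n) (hq : 1 ≤ q) (v : Perm (Fin (n + q - 1))) :
    fMap n q (Psi n q v) = rtlFoata (fMap n q v) := by
  apply canon_injective
  rw [canon_fMap hn hq, canon_Psi hn hq]
  funext i
  have h1 := isCode_canon (rtlFoata (fMap n q v)) i
  have h2 := isCode_canon v (i + q - 1)
  simp only [downCode, upCode]
  rw [show i + q - 1 - (q - 1) = i by omega]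
  rcases lt_or_ge i n with hi | hi
  · have h3 := canon_rtlFoata_fMap_eq_one hn hq v hi
    split_ifs with h <;> omega
  · have h3 := (isCanonical_canon (rtlFoata (fMap n q v))).2.1 i hi
    split_ifs with h <;> omega

/-- `f_q(v)` is recovered because `rev Φ rev` is injective. Then `c j` was either copied into the
image, or it exceeds `q` and is determined by the code of `f_q(v)`. -/
theorem Psi_injective (hn : 1 ≤ n) (hq : 1 ≤ q) : Function.Injective (Psi n q) := by
  intro v v' h
  have hf : fMap n q v = fMap n q v' := rtlFoata_injective (by
    rw [← fMap_Psi hn hq, h, fMap_Psi hn hq])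
  apply canon_injective
  funext j
  have h1 := congrFun (congrArg canon h) j
  rw [canon_Psi hn hq, canon_Psi hn hq, hf] at h1
  simp only [upCode] at h1
  split_ifs at h1 with h2
  · exact h1
  · rw [not_or] at h2
    rcases lt_or_ge j (n + q - 1) with hj | hj
    · have h3 := canon_rtlFoata_fMap_eq_one hn hq v (i := j - (q - 1)) (by omega)
      have h4 := canon_rtlFoata_fMap_eq_one hn hq v' (i := j - (q - 1)) (by omega)
      have h5 := congrFun (congrArg canon hf) (j - (q - 1))
      rw [canon_fMap hn hq, canon_fMap hn hq] at h5
      simp only [downCode] at h5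
      rw [show j - (q - 1) + q - 1 = j by omega] at h3 h4 h5
      rw [hf] at h3
      omega
    · rw [(isCanonical_canon v).2.1 j hj, (isCanonical_canon v').2.1 j hj]

theorem Psi_bijective (hn : 1 ≤ n) (hq : 1 ≤ q) : Function.Bijective (Psi n q) :=
  Finite.injective_iff_bijective.1 (Psi_injective hn hq)

theorem qRmaj_eq_qLength_Psi (hn : 1 ≤ n) (hq : 1 ≤ q) (v : Perm (Fin (n + q - 1))) :
    qRmaj q v = qLength q (Psi n q v) := by
  rw [qRmaj_eq hn hq, qLength_eq_sum hn hq, fMap_Psi hn hq, sum_code_rtlFoata]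

theorem qDel_inv_Psi (hn : 1 ≤ n) (hq : 1 ≤ q) (v : Perm (Fin (n + q - 1))) :
    qDel q v⁻¹ = qDel q (Psi n q v)⁻¹ := by
  ext j
  rw [mem_qDel_inv, mem_qDel_inv, canon_Psi hn hq]
  refine and_congr_right fun ⟨h1, h2⟩ => ?_
  have h3 := canon_rtlFoata_fMap_eq_one hn hq v (i := j - 1 - (q - 1)) (by omega)
  rw [show j - 1 - (q - 1) + q - 1 = j - 1 by omega] at h3
  have h4 := isCode_canon (rtlFoata (fMap n q v)) (j - 1 - (q - 1))
  simp only [upCode]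
  split_ifs with h <;> omega

theorem qDes_inv_Psi (hn : 1 ≤ n) (hq : 1 ≤ q) (v : Perm (Fin (n + q - 1))) :
    qDes q v⁻¹ = qDes q (Psi n q v)⁻¹ := by
  ext i
  rw [mem_qDes_inv hn hq, mem_qDes_inv hn hq, fMap_Psi hn hq]
  exact and_congr_right fun ⟨h1, h2⟩ => (canon_rtlFoata_le _ (by omega)).symm

/-! ### Pattern avoidance -/

theorem exists_perm_lt_iff {f : Fin q → ℕ} (hf : Function.Injective f) :
    ∃ τ : Perm (Fin q), ∀ a b, f a < f b ↔ τ a < τ b := by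
  have hs : StrictMono (f ∘ Tuple.sort f) :=
    (Tuple.monotone_sort f).strictMono_of_injective (hf.comp (Tuple.sort f).injective)
  refine ⟨(Tuple.sort f)⁻¹, fun a b => ?_⟩
  rw [← hs.lt_iff_lt]
  simp

theorem letter_injOn {m : ℕ} (σ : Perm (Fin m)) {i j : ℕ} (hi : 1 ≤ i ∧ i ≤ m) (hj : 1 ≤ j ∧ j ≤ m)
    (h : letter σ i = letter σ j) : i = j := by
  rw [letter, letter, dif_pos hi, dif_pos hj] at h
  have := σ.injective (Fin.ext (Nat.succ_injective h))
  rw [Fin.mk.injEq] at this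
  omega

/-- An occurrence of some pattern is a descent at `k` with at least `q` letters smaller than
`σ(k+1)` before it, that is, a descent with `k + 1 ∉ Del_q`. Their order is immaterial, as every `τ`
is forbidden. -/
theorem mem_qAvoid_iff {m : ℕ} (hq : 1 ≤ q) (σ : Perm (Fin m)) :
    σ ∈ qAvoid q m ↔ ∀ i ∈ qDes q σ, i + 1 ∈ qDel q σ := by
  constructor
  · intro h i hi
    by_contra hcon
    simp only [qDes, Finset.mem_filter, Finset.mem_Icc] at hi
    have hdes := hi.2.resolve_right hcon
    simp only [descents, Finset.mem_filter] at hdes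
    simp only [qDel, Finset.mem_filter, Finset.mem_Icc, not_and, not_lt] at hcon
    obtain ⟨S, hS, hSc⟩ := Finset.exists_subset_card_eq (hcon (by omega))
    have hmem : ∀ a, 1 ≤ S.orderEmbOfFin hSc a ∧ S.orderEmbOfFin hSc a < i ∧
        letter σ (S.orderEmbOfFin hSc a) < letter σ (i + 1) := by
      intro a
      have := hS (Finset.orderEmbOfFin_mem S hSc a)
      rw [Finset.mem_filter, Finset.mem_Ico] at this
      refine ⟨this.1.1, ?_, this.2⟩
      -- The position `i` itself is excluded because `σ(i) > σ(i + 1)`.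
      refine lt_of_le_of_ne (by omega) fun e => ?_
      rw [e] at this
      omega
    obtain ⟨τ, hτ⟩ := exists_perm_lt_iff (f := fun a => letter σ (S.orderEmbOfFin hSc a))
      fun a b hab => (S.orderEmbOfFin hSc).injective (letter_injOn σ
        ⟨(hmem a).1, by have := (hmem a).2.1; omega⟩ ⟨(hmem b).1, by have := (hmem b).2.1; omega⟩ hab)
    exact h τ ⟨S.orderEmbOfFin hSc, i, (S.orderEmbOfFin hSc).strictMono,
      fun a => ⟨(hmem a).1, (hmem a).2.1⟩, by omega, by omega, hτ, fun a => (hmem a).2.2, hdes.2⟩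
  · rintro h τ ⟨p, k, hp, hpk, hk1, hkm, _, hlt, hdes⟩
    have hcard : q ≤ #{i ∈ Finset.Ico 1 k | letter σ i < letter σ (k + 1)} := by
      calc q = #(Finset.univ.map ⟨p, hp.injective⟩) := by simp
        _ ≤ _ := Finset.card_le_card fun i hi => by
          obtain ⟨a, _, rfl⟩ := Finset.mem_map.1 hi
          simpa using ⟨hpk a, hlt a⟩
    have hqk : q < k := by
      have := hcard.trans (Finset.card_filter_le _ _)
      rw [Nat.card_Ico] at this
      omega
    have hdel := h k (by
      simp only [qDes, descents, Finset.mem_filter, Finset.mem_Icc]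
      exact ⟨by omega, Or.inl ⟨by omega, hdes⟩⟩)
    simp only [qDel, Finset.mem_filter] at hdel
    refine absurd hdel.2 (not_lt.2 (hcard.trans (Finset.card_le_card ?_)))
    exact Finset.filter_subset_filter _ (Finset.Ico_subset_Ico_right (by omega))

/-! ### Restriction to invariant sets -/

theorem Psi_bijOn (hn : 1 ≤ n) (hq : 1 ≤ q) (E : Set (Perm (Fin (n + q - 1))))
    (hE : ∀ v, Psi n q v ∈ E ↔ v ∈ E) :
    Set.BijOn (Psi n q) E E ∧ genPoly E (qLength q) = genPoly E (qRmaj q) := by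
  refine ⟨⟨fun v hv => (hE v).2 hv, (Psi_injective hn hq).injOn, fun w hw => ?_⟩, ?_⟩
  · obtain ⟨v, rfl⟩ := (Psi_bijective hn hq).2 w
    exact ⟨v, (hE v).1 hw, rfl⟩
  · classical
    rw [genPoly, genPoly, Finset.sum_filter, Finset.sum_filter,
      ← (Psi_bijective hn hq).sum_comp]
    refine Finset.sum_congr rfl fun v _ => ?_
    simp only [hE, qRmaj_eq_qLength_Psi hn hq]

end Psi

end FoataQ

open FoataQ
theorem mainTheorem2 (n q : ℕ) (hn : 1 ≤ n) (hq : 1 ≤ q) :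
    Function.Bijective (Psi n q) ∧
    (∀ v : Equiv.Perm (Fin (n + q - 1)), qRmaj q v = qLength q (Psi n q v)) ∧
    (∀ v : Equiv.Perm (Fin (n + q - 1)), qDel q v⁻¹ = qDel q (Psi n q v)⁻¹) ∧
    (∀ v : Equiv.Perm (Fin (n + q - 1)), qDes q v⁻¹ = qDes q (Psi n q v)⁻¹) ∧
    (∀ B₁ B₂ : Finset ℕ, B₁ ⊆ Finset.Icc q (n + q - 1) → B₂ ⊆ Finset.Icc q (n + q - 1) →
      Set.BijOn (Psi n q) {π | qDes q π⁻¹ = B₁ ∧ qDel q π⁻¹ = B₂}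
          {π | qDes q π⁻¹ = B₁ ∧ qDel q π⁻¹ = B₂} ∧
      genPoly {π : Equiv.Perm (Fin (n + q - 1)) | qDes q π⁻¹ = B₁ ∧ qDel q π⁻¹ = B₂} (qLength q) =
        genPoly {π : Equiv.Perm (Fin (n + q - 1)) | qDes q π⁻¹ = B₁ ∧ qDel q π⁻¹ = B₂}
          (qRmaj q)) ∧
    (∀ B : Finset ℕ, B ⊆ Finset.Icc q (n + q - 2) →
      Set.BijOn (Psi n q) {π | π⁻¹ ∈ qAvoid q (n + q - 1) ∧ qDes q π⁻¹ = B}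
          {π | π⁻¹ ∈ qAvoid q (n + q - 1) ∧ qDes q π⁻¹ = B} ∧
      genPoly {π : Equiv.Perm (Fin (n + q - 1)) | π⁻¹ ∈ qAvoid q (n + q - 1) ∧ qDes q π⁻¹ = B}
          (qLength q) =
        genPoly {π : Equiv.Perm (Fin (n + q - 1)) | π⁻¹ ∈ qAvoid q (n + q - 1) ∧ qDes q π⁻¹ = B}
          (qRmaj q)) := by
  refine ⟨Psi_bijective hn hq, qRmaj_eq_qLength_Psi hn hq, qDel_inv_Psi hn hq, qDes_inv_Psi hn hq,
    fun B₁ B₂ _ _ => Psi_bijOn hn hq _ fun v => ?_, fun B _ => Psi_bijOn hn hq _ fun v => ?_⟩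
  · rw [Set.mem_ofPred_eq, Set.mem_ofPred_eq, ← qDel_inv_Psi hn hq, ← qDes_inv_Psi hn hq]
  · rw [Set.mem_ofPred_eq, Set.mem_ofPred_eq, mem_qAvoid_iff hq, mem_qAvoid_iff hq,
      ← qDel_inv_Psi hn hq, ← qDes_inv_Psi hn hq]
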